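/- Let $m\ge \ell\ge 3$ be fixed integers and let $\alpha=\ell/m$. For each $n$ such that $r=\ell n/m$ is an integer, let $\mathbb{A}(\ell,m)$ be the ensemble of equiprobable binary $r\times n$ matrices $H$ all of whose columns have Hamming weight $\ell$ and all of whose rows have Hamming weight $m$. Let $h(\beta)=-\beta\log_2\beta-(1-\beta)\log_2(1-\beta)$ be the binary entropy function. For $0<\beta<1$ (and $\beta<1-\frac1m$ if $m$ is odd) let $$q(\alpha,\beta)=\alpha\log_2\frac{(1+t)^m+(1-t)^m}{2t^{\beta m}}-\alpha m h(\beta),$$ where $t$ is the unique positive root of the equation $$\frac{(1+t)^{m-1}+(1-t)^{m-1}}{(1+t)^m+(1-t)^m}=1-\beta .$$ Let $q(\alpha,\beta)=-\infty$ if $m$ is odd and $\beta\ge 1-\frac1m$, and let $q(\alpha,1)=0$ (the limiting value) if $m$ is even. Let $0<\theta\le 1$ and, for each $n$, let $J=J_n$ be any given set of $\lfloor\theta n\rfloor$ of the $n$ positions. For $H\in\mathbb{A}(\ell,m)$ let $C_J$ be the shortened code that consists of the restrictions $c_J$ of all $c\in\mathbb{F}_2^n$ with $Hc=0$ that vanish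 outside $J$. Let $N_\theta$ be the average number of nonzero codewords of $C_J$ over all $H\in\mathbb{A}(\ell,m)$. Then, as $n\to\infty$ over the integers $n$ with $m\mid \ell n$, the ensemble is eventually nonempty, eventually $N_\theta>0$, and $$\lim_{n\to\infty}\tfrac1n\log_2 N_\theta=f(\theta),\qquad f(\theta)=\sup_{0<\beta\le 1}\bigl\{q(\alpha,\beta\theta)+\theta h(\beta)\bigr\},$$ where $f(\theta)$ is finite, and the supremum is attained (it is a maximum) whenever $f(\theta)>0$. -/

import Mathlib

open Filter Topology

noncomputable section

namespace LDPC

/-- The support of the regular ensemble with parameters `ℓ`, `m`: all binary `r × n` matrices in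
which every column has Hamming weight `ℓ` and every row has Hamming weight `m`. -/
def ensemble (ℓ m r n : ℕ) : Finset (Matrix (Fin r) (Fin n) (ZMod 2)) :=
  Finset.univ.filter fun H =>
    (∀ j, hammingNorm (fun i => H i j) = ℓ) ∧ (∀ i, hammingNorm (fun j => H i j) = m)

/-- The binary linear code with parity-check matrix `H`. -/
def code {r n : ℕ} (H : Matrix (Fin r) (Fin n) (ZMod 2)) : Submodule (ZMod 2) (Fin n → ZMod 2) :=
  LinearMap.ker H.mulVecLin

/-- The code with parity-check matrix `H`, shortened to the positions `J`: the restrictions to `J`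
of the codewords that vanish outside `J`. -/
def shortenedCode {r n : ℕ} (H : Matrix (Fin r) (Fin n) (ZMod 2)) (J : Finset (Fin n)) :
    Set (J → ZMod 2) :=
  {x | ∃ c ∈ code H, (∀ i, i ∉ J → c i = 0) ∧ x = fun j : J => c j}

/-- The number of nonzero codewords of the shortened code. -/
def numNonzero {r n : ℕ} (H : Matrix (Fin r) (Fin n) (ZMod 2)) (J : Finset (Fin n)) : ℕ :=
  {x | x ∈ shortenedCode H J ∧ x ≠ 0}.ncard

/-- The average of the number of nonzero codewords of the code shortened to `J`, over equiprobable
parity-check matrices of the ensemble of length `n`, which have `r = ℓ n / m` rows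
(used only when `m` divides `ℓ n`). -/
def avgNonzero (ℓ m n : ℕ) (J : Finset (Fin n)) : ℝ :=
  (∑ H ∈ ensemble ℓ m (ℓ * n / m) n, (numNonzero H J : ℝ)) / (ensemble ℓ m (ℓ * n / m) n).card

/-- The binary entropy function, in bits. -/
def h (β : ℝ) : ℝ := Real.binEntropy β / Real.log 2

/-- `t` is a positive root of
`((1+t)^(m-1) + (1-t)^(m-1)) / ((1+t)^m + (1-t)^m) = 1 - β`. -/
def IsPosRoot (m : ℕ) (β t : ℝ) : Prop :=
  0 < t ∧ ((1 + t) ^ (m - 1) + (1 - t) ^ (m - 1)) / ((1 + t) ^ m + (1 - t) ^ m) = 1 - β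

/-- The positive root. It exists and is unique if `m ≥ 3`, `0 < β < 1` and, for odd `m`,
`β < 1 - 1/m`; it is used only in this range. -/
def root (m : ℕ) (β : ℝ) : ℝ := Classical.epsilon (IsPosRoot m β)

/-- The exponent `q(α, β)` for row weight `m`. For odd `m` and `β ≥ 1 - 1/m` it is `-∞`.
At `β = 0`, and at `β = 1` for even `m`, where the root degenerates to `0` and to `∞`,
it is the limiting value `0` of the general formula. -/
def q (m : ℕ) (α β : ℝ) : EReal :=
  open Classical in
  if Odd m ∧ 1 - 1 / (m : ℝ) ≤ β then ⊥
  else if β = 0 ∨ β = 1 then 0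
  else ((α * Real.logb 2
      (((1 + root m β) ^ m + (1 - root m β) ^ m) / (2 * root m β ^ (β * (m : ℝ))))
      - α * (m : ℝ) * h β : ℝ) : EReal)

/-- The function `q(α, βθ) + θ h(β)` of `β`, with `α = ℓ / m`. -/
def objective (ℓ m : ℕ) (θ β : ℝ) : EReal :=
  q m ((ℓ : ℝ) / (m : ℝ)) (β * θ) + ((θ * h β : ℝ) : EReal)

end LDPC

end

/-! By linearity the mean is a sum, over nonempty `T ⊆ J`, of the probability that the indicator of
`T` is a codeword, that is, that every row has an even number of ones in `T`. In the configuration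
model, where column half-edges are matched with row half-edges by a uniform bijection, the
half-edges at `w` columns land on a uniform set of `w * ℓ` row half-edges. Evenness then has
probability exactly `evenCount r m (w * ℓ) / (r * m).choose (w * ℓ)`, where `evenCount` is a
coefficient of the `r`-th power of `((1 + t) ^ m + (1 - t) ^ m) / 2`.

Every matrix of the ensemble comes from the same number of simple configurations, so only multiple
edges separate the two models. The switching argument `card_le_mul_card_simple` shows that simple
configurations make up at least an inverse polynomial fraction of all configurations and, when `T`
and its complement are large, also of those even on `T`. Exponents are not affected.

The rate of the coefficients is `evenDual`, the Legendre dual of `log evenZ`, with `t = exp u`.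
Chernoff's bound gives one direction; tilting by the `u` that makes the wanted weight the mean gives
the other (`exists_evenCount_mul_large`). This condition on `u` is the root equation
(`isPosRoot_exp_iff`). With entropy bounds for the binomial coefficients, weight `x * n` contributes
`exp (n * growth ℓ m θ x)` up to subexponential factors. There are at most `n` weights, so the rate
is the maximum of the continuous function `growth` on a compact interval.

The objective omits the end point `x = 0` and, for odd `m`, equals `-∞` at `x = 1 - 1/m`. By
continuity this does not change the supremum. A positive maximum is not at `0`, where `growth`
vanishes, nor at `1 - 1/m`, where the dual has infinite slope (`not_isMaxOn_growth`); hence it is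
attained by the objective. -/

namespace LDPC

/-! ### Convex duality for the logarithm of a partition function -/

/-- The partition function `∑ exp (κ i * u)` of a finite family of energies `κ`. -/
noncomputable def partitionFn {ι : Type*} (s : Finset ι) (κ : ι → ℝ) (u : ℝ) : ℝ :=
  ∑ i ∈ s, Real.exp (κ i * u)

/-- The mean of `κ` under the weights `exp (κ i * u)`. -/
noncomputable def gibbsMean {ι : Type*} (s : Finset ι) (κ : ι → ℝ) (u : ℝ) : ℝ :=
  (∑ i ∈ s, κ i * Real.exp (κ i * u)) / partitionFn s κ u

/-- The concave dual of the logarithm of the partition function. -/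
noncomputable def dualFn {ι : Type*} (s : Finset ι) (κ : ι → ℝ) (y : ℝ) : ℝ :=
  ⨅ u : ℝ, (Real.log (partitionFn s κ u) - y * u)

section Partition

variable {ι : Type*} {s : Finset ι} {κ : ι → ℝ}

theorem partitionFn_pos (hs : s.Nonempty) (u : ℝ) : 0 < partitionFn s κ u :=
  Finset.sum_pos (fun _ _ => Real.exp_pos _) hs

theorem hasDerivAt_partitionFn (u : ℝ) :
    HasDerivAt (partitionFn s κ) (∑ i ∈ s, κ i * Real.exp (κ i * u)) u := by
  unfold partitionFn
  refine HasDerivAt.fun_sum fun i _ => ?_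
  have h := ((hasDerivAt_id u).const_mul (κ i)).exp
  simpa [mul_comm] using h

theorem hasDerivAt_log_partitionFn (hs : s.Nonempty) (u : ℝ) :
    HasDerivAt (fun u => Real.log (partitionFn s κ u)) (gibbsMean s κ u) u :=
  (hasDerivAt_partitionFn u).log (partitionFn_pos hs u).ne'

/-- Convexity of the log-partition function in tangent form: average `1 + x ≤ exp x` at `x = (κ i -
μ) * (v - u)` over the Gibbs weights at `u`; the linear term cancels because `μ` is the mean. -/
theorem log_partitionFn_tangent (hs : s.Nonempty) (u v : ℝ) :
    Real.log (partitionFn s κ u) + gibbsMean s κ u * (v - u) ≤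
      Real.log (partitionFn s κ v) := by
  have hu := partitionFn_pos (κ := κ) hs u
  set μ := gibbsMean s κ u with hμ
  have hμ' : ∑ i ∈ s, κ i * Real.exp (κ i * u) = μ * partitionFn s κ u := by
    rw [hμ, gibbsMean, div_mul_cancel₀ _ hu.ne']
  rw [Real.le_log_iff_exp_le (partitionFn_pos hs v), Real.exp_add, Real.exp_log hu]
  have key : ∀ i ∈ s, Real.exp (μ * (v - u)) * (Real.exp (κ i * u) * (1 + (κ i - μ) * (v - u))) ≤
      Real.exp (κ i * v) := by
    intro i _
    have h1 : Real.exp (κ i * v) =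
        Real.exp (μ * (v - u)) * (Real.exp (κ i * u) * Real.exp ((κ i - μ) * (v - u))) := by
      rw [← Real.exp_add, ← Real.exp_add]; congr 1; ring
    rw [h1]
    have h2 := Real.add_one_le_exp ((κ i - μ) * (v - u))
    gcongr
    linarith
  have h3 := Finset.sum_le_sum key
  rw [← Finset.mul_sum] at h3
  have h4 : ∑ i ∈ s, Real.exp (κ i * u) * (1 + (κ i - μ) * (v - u)) = partitionFn s κ u := by
    have : ∀ i ∈ s, Real.exp (κ i * u) * (1 + (κ i - μ) * (v - u)) =
        (1 - μ * (v - u)) * Real.exp (κ i * u) + (v - u) * (κ i * Real.exp (κ i * u)) := by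
      intros; ring
    rw [Finset.sum_congr rfl this, Finset.sum_add_distrib, ← Finset.mul_sum, ← Finset.mul_sum, hμ']
    unfold partitionFn; ring
  rw [h4, mul_comm] at h3
  exact h3

theorem gibbsMean_mono (hs : s.Nonempty) {u v : ℝ} (h : u ≤ v) :
    gibbsMean s κ u ≤ gibbsMean s κ v := by
  rcases h.eq_or_lt with rfl | h
  · rfl
  have h1 := log_partitionFn_tangent (κ := κ) hs u v
  have h2 := log_partitionFn_tangent (κ := κ) hs v u
  nlinarith

theorem gibbsMean_lt (hs : s.Nonempty) {c : ℝ} (hc : ∀ i ∈ s, κ i ≤ c)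
    (hc' : ∃ i ∈ s, κ i < c) (u : ℝ) : gibbsMean s κ u < c := by
  rw [gibbsMean, div_lt_iff₀ (partitionFn_pos hs u), partitionFn, Finset.mul_sum]
  refine Finset.sum_lt_sum (fun i hi => ?_) ?_
  · exact mul_le_mul_of_nonneg_right (hc i hi) (Real.exp_pos _).le
  · obtain ⟨i, hi, h⟩ := hc'
    exact ⟨i, hi, mul_lt_mul_of_pos_right h (Real.exp_pos _)⟩

theorem mul_le_log_partitionFn {i : ι} (hi : i ∈ s) (u : ℝ) :
    κ i * u ≤ Real.log (partitionFn s κ u) := by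
  rw [Real.le_log_iff_exp_le (partitionFn_pos ⟨i, hi⟩ u)]
  exact Finset.single_le_sum (f := fun i => Real.exp (κ i * u)) (fun _ _ => (Real.exp_pos _).le) hi

theorem log_partitionFn_sub_nonneg {i j : ι} (hi : i ∈ s) (hj : j ∈ s) {y : ℝ}
    (hy : y ∈ Set.Icc (κ i) (κ j)) (u : ℝ) : 0 ≤ Real.log (partitionFn s κ u) - y * u := by
  have h1 := mul_le_log_partitionFn (κ := κ) hi u
  have h2 := mul_le_log_partitionFn (κ := κ) hj u
  rcases le_total 0 u with h | h
  · nlinarith [mul_le_mul_of_nonneg_right hy.2 h]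
  · nlinarith [mul_le_mul_of_nonpos_right hy.1 h]

/-- An infimum of reals that is not bounded below has the default value `0`, so upper bounds for
`dualFn` require `y` to lie between two energies. -/
theorem bddBelow_dualFn {i j : ι} (hi : i ∈ s) (hj : j ∈ s) {y : ℝ}
    (hy : y ∈ Set.Icc (κ i) (κ j)) :
    BddBelow (Set.range fun u : ℝ => Real.log (partitionFn s κ u) - y * u) := by
  refine ⟨0, ?_⟩
  rintro _ ⟨u, rfl⟩
  exact log_partitionFn_sub_nonneg hi hj hy u

theorem dualFn_nonneg {i j : ι} (hi : i ∈ s) (hj : j ∈ s) {y : ℝ}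
    (hy : y ∈ Set.Icc (κ i) (κ j)) : 0 ≤ dualFn s κ y :=
  le_ciInf fun u => log_partitionFn_sub_nonneg hi hj hy u

theorem dualFn_le {i j : ι} (hi : i ∈ s) (hj : j ∈ s) {y : ℝ}
    (hy : y ∈ Set.Icc (κ i) (κ j)) (u : ℝ) :
    dualFn s κ y ≤ Real.log (partitionFn s κ u) - y * u :=
  ciInf_le (bddBelow_dualFn hi hj hy) u

theorem dualFn_gibbsMean (hs : s.Nonempty) (u : ℝ) :
    dualFn s κ (gibbsMean s κ u) =
      Real.log (partitionFn s κ u) - gibbsMean s κ u * u := by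
  have h : ∀ v, Real.log (partitionFn s κ u) - gibbsMean s κ u * u ≤
      Real.log (partitionFn s κ v) - gibbsMean s κ u * v := fun v => by
    linarith [log_partitionFn_tangent (κ := κ) hs u v]
  exact le_antisymm (ciInf_le ⟨_, by rintro _ ⟨v, rfl⟩; exact h v⟩ u) (le_ciInf h)

/-- For `y` strictly between two energies, `log Z - y * u` is coercive because the two corresponding
terms bound it below by lines of opposite slopes. The derivative vanishes at a minimiser. -/
theorem exists_gibbsMean_eq {i j : ι} (hi : i ∈ s) (hj : j ∈ s) {y : ℝ}
    (hy : y ∈ Set.Ioo (κ i) (κ j)) : ∃ u, gibbsMean s κ u = y := by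
  have hd : ∀ u, HasDerivAt (fun u => Real.log (partitionFn s κ u) - y * u)
      (gibbsMean s κ u - y) u := fun u => by
    simpa using (hasDerivAt_log_partitionFn ⟨i, hi⟩ u).fun_sub ((hasDerivAt_id u).const_mul y)
  have hcont : Continuous fun u => Real.log (partitionFn s κ u) - y * u :=
    continuous_iff_continuousAt.2 fun u => (hd u).continuousAt
  have htop : Tendsto (fun u => Real.log (partitionFn s κ u) - y * u) (cocompact ℝ) atTop := by
    rw [cocompact_eq_atBot_atTop, tendsto_sup]
    constructor
    · refine tendsto_atTop_mono (f := fun u => (κ i - y) * u) (fun u => ?_)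
        ((tendsto_const_mul_atTop_of_neg (by linarith [hy.1])).2 tendsto_id)
      linarith [mul_le_log_partitionFn (κ := κ) hi u]
    · refine tendsto_atTop_mono (f := fun u => (κ j - y) * u) (fun u => ?_)
        ((tendsto_const_mul_atTop_of_pos (by linarith [hy.2])).2 tendsto_id)
      linarith [mul_le_log_partitionFn (κ := κ) hj u]
  obtain ⟨u, hu⟩ := hcont.exists_forall_le htop
  refine ⟨u, ?_⟩
  have := (IsLocalMin.hasDerivAt_eq_zero (Eventually.of_forall hu) (hd u))
  linarith

theorem concaveOn_dualFn {i j : ι} (hi : i ∈ s) (hj : j ∈ s) :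
    ConcaveOn ℝ (Set.Icc (κ i) (κ j)) (dualFn s κ) := by
  refine ⟨convex_Icc _ _, fun x hx y hy a b ha hb hab => le_ciInf fun u => ?_⟩
  have h1 := mul_le_mul_of_nonneg_left (dualFn_le hi hj hx u) ha
  have h2 := mul_le_mul_of_nonneg_left (dualFn_le hi hj hy u) hb
  simp only [smul_eq_mul]
  have : Real.log (partitionFn s κ u) =
      a * Real.log (partitionFn s κ u) + b * Real.log (partitionFn s κ u) := by
    rw [← add_mul, hab, one_mul]
  rw [this]
  nlinarith

/-- Upper semicontinuity, as for any infimum of continuous functions: a single `u` that is good at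
`x` remains good nearby. -/
theorem dualFn_eventually_lt {i j : ι} (hi : i ∈ s) (hj : j ∈ s) {x c : ℝ}
    (hc : dualFn s κ x < c) :
    ∀ᶠ y in 𝓝[Set.Icc (κ i) (κ j)] x, dualFn s κ y < c := by
  obtain ⟨u, hu⟩ := exists_lt_of_ciInf_lt hc
  have h1 : ContinuousAt (fun y => Real.log (partitionFn s κ u) - y * u) x := by fun_prop
  filter_upwards [nhdsWithin_le_nhds (h1.eventually_lt_const hu), self_mem_nhdsWithin] with y hy hy'
  exact (dualFn_le hi hj hy' u).trans_lt hy

/-- Lower semicontinuity, including at the end points, comes from concavity: near `x` the function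
lies above the chords joining `x` to the two ends of the interval, and these are continuous. -/
theorem dualFn_eventually_gt {i j : ι} (hi : i ∈ s) (hj : j ∈ s) {x : ℝ}
    (hx : x ∈ Set.Icc (κ i) (κ j)) {c : ℝ} (hc : c < dualFn s κ x) :
    ∀ᶠ y in 𝓝[Set.Icc (κ i) (κ j)] x, c < dualFn s κ y := by
  have hcv := concaveOn_dualFn (κ := κ) hi hj
  have hle : κ i ≤ κ j := hx.1.trans hx.2
  have chord : ∀ e ∈ Set.Icc (κ i) (κ j), e ≠ x → ∀ᶠ y in 𝓝 x,
      0 ≤ (y - x) / (e - x) → (y - x) / (e - x) ≤ 1 → c < dualFn s κ y := by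
    intro e he hex
    have hne : e - x ≠ 0 := sub_ne_zero.2 hex
    have h1 : ContinuousAt (fun y => (1 - (y - x) / (e - x)) * dualFn s κ x +
        (y - x) / (e - x) * dualFn s κ e) x := by fun_prop
    have h2 := h1.eventually_const_lt (u := c) (by simpa using hc)
    filter_upwards [h2] with y hy h0 h1
    refine hy.trans_le ?_
    have := hcv.2 hx he (sub_nonneg.2 h1) h0 (by ring)
    simp only [smul_eq_mul] at this
    convert this using 2
    field_simp
    ring
  have hR : ∀ᶠ y in 𝓝 x, x < y → y ≤ κ j → c < dualFn s κ y := by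
    rcases hx.2.eq_or_lt with h | h
    · exact Eventually.of_forall fun y h1 h2 => absurd h1 (by linarith)
    · filter_upwards [chord (κ j) ⟨hle, le_rfl⟩ h.ne'] with y hy h1 h2
      exact hy (div_nonneg (by linarith) (by linarith))
        ((div_le_one (by linarith)).2 (by linarith))
  have hL : ∀ᶠ y in 𝓝 x, y < x → κ i ≤ y → c < dualFn s κ y := by
    rcases hx.1.eq_or_lt with h | h
    · exact Eventually.of_forall fun y h1 h2 => absurd h1 (by linarith)
    · filter_upwards [chord (κ i) ⟨le_rfl, hle⟩ h.ne] with y hy h1 h2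
      exact hy (div_nonneg_of_nonpos (by linarith) (by linarith))
        ((div_le_one_of_neg (by linarith)).2 (by linarith))
  filter_upwards [nhdsWithin_le_nhds hR, nhdsWithin_le_nhds hL, self_mem_nhdsWithin] with y h1 h2 h3
  rcases lt_trichotomy x y with h | rfl | h
  · exact h1 h h3.2
  · exact hc
  · exact h2 h h3.1

theorem continuousOn_dualFn {i j : ι} (hi : i ∈ s) (hj : j ∈ s) :
    ContinuousOn (dualFn s κ) (Set.Icc (κ i) (κ j)) := fun _ hx =>
  tendsto_order.2 ⟨fun _ hc => dualFn_eventually_gt hi hj hx hc,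
    fun _ hc => dualFn_eventually_lt hi hj hc⟩

/-- The dual function has slope `-∞` at its right end point. -/
theorem dualFn_steep {i j : ι} (hi : i ∈ s) (hj : j ∈ s) (hij : κ i < κ j)
    (hmax : ∀ k ∈ s, κ k ≤ κ j) (L : ℝ) :
    ∀ᶠ y in 𝓝[<] (κ j), dualFn s κ (κ j) + L * (κ j - y) ≤ dualFn s κ y := by
  have hs : s.Nonempty := ⟨i, hi⟩
  have h1 : gibbsMean s κ L < κ j := gibbsMean_lt hs hmax ⟨i, hi, hij⟩ L
  filter_upwards [Ioo_mem_nhdsLT (max_lt h1 hij)] with y hy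
  -- The point `y` is the mean at some `u`, and `u ≥ L` because `y` exceeds the mean at `L`. The
  -- dual equals `log Z - y * u` at `y` and is at most `log Z - κ j * u` at `κ j`, so it drops by at
  -- least `u * (κ j - y)`.
  obtain ⟨u, hu⟩ := exists_gibbsMean_eq hi hj ⟨(le_max_right _ _).trans_lt hy.1, hy.2⟩
  have hLu : L ≤ u := by
    by_contra! h
    have := gibbsMean_mono (κ := κ) hs h.le
    have := (le_max_left (gibbsMean s κ L) (κ i)).trans_lt hy.1
    linarith
  have h2 := dualFn_gibbsMean (κ := κ) hs u
  rw [hu] at h2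
  have h3 := dualFn_le (κ := κ) hi hj ⟨hij.le, le_rfl⟩ u
  nlinarith [mul_le_mul_of_nonneg_right hLu (sub_nonneg.2 hy.2.le)]

/-- The dual function vanishes at `y` if the normalised partition function approaches `1`. -/
theorem dualFn_eq_zero_of_tendsto {i j : ι} (hi : i ∈ s) (hj : j ∈ s) {y : ℝ}
    (hy : y ∈ Set.Icc (κ i) (κ j)) {F : Filter ℝ} [F.NeBot]
    (h : Tendsto (fun u => ∑ k ∈ s, Real.exp ((κ k - y) * u)) F (𝓝 1)) :
    dualFn s κ y = 0 := by
  refine le_antisymm ?_ (dualFn_nonneg hi hj hy)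
  have h1 : Tendsto (fun u => Real.log (∑ k ∈ s, Real.exp ((κ k - y) * u))) F (𝓝 0) := by
    simpa using h.log one_ne_zero
  refine ge_of_tendsto h1 (Eventually.of_forall fun u => (dualFn_le hi hj hy u).trans_eq ?_)
  have h2 : ∑ k ∈ s, Real.exp ((κ k - y) * u) = partitionFn s κ u * Real.exp (-(y * u)) := by
    rw [partitionFn, Finset.sum_mul]
    refine Finset.sum_congr rfl fun k _ => ?_
    rw [← Real.exp_add]; congr 1; ring
  rw [h2, Real.log_mul (partitionFn_pos ⟨i, hi⟩ u).ne' (Real.exp_ne_zero _), Real.log_exp]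
  ring

end Partition

/-! ### Switchings: bijections without bad pairs are not rare -/

section Switching

theorem card_filter_row_eq_le {A B U : Type*} [Fintype A] [Fintype B] [DecidableEq U]
    {row : B → U} {k : ℕ}
    (hrow : ∀ u, (Finset.univ.filter fun b => row b = u).card ≤ k) (σ : A ≃ B) (u : U) :
    (Finset.univ.filter fun a => row (σ a) = u).card ≤ k := by
  refine le_trans (le_of_eq ?_) (hrow u)
  refine Finset.card_bij (fun a _ => σ a) (by simp) (fun a _ b _ h => σ.injective h) fun b hb => ?_
  exact ⟨σ.symm b, by simpa using hb, by simp⟩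

/-- The ordered pairs of distinct half-edges with the same column whose partners lie in the
same row, that is, the pairs which produce a multiple edge. -/
def badPairs {A B V U : Type*} [Fintype A] [DecidableEq A]
    [DecidableEq V] [DecidableEq U] (col : A → V) (row : B → U) (σ : A ≃ B) : Finset (A × A) :=
  Finset.univ.filter fun p => p.1 ≠ p.2 ∧ col p.1 = col p.2 ∧ row (σ p.1) = row (σ p.2)

theorem mem_badPairs {A B V U : Type*} [Fintype A] [DecidableEq A]
    [DecidableEq V] [DecidableEq U] {col : A → V} {row : B → U} {σ : A ≃ B} {a b : A} :
    (a, b) ∈ badPairs col row σ ↔ a ≠ b ∧ col a = col b ∧ row (σ a) = row (σ b) := by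
  simp [badPairs]

variable {A B V U W : Type*} [Fintype A] [DecidableEq A] [Fintype B]
  [DecidableEq V] [DecidableEq U] [DecidableEq W]

/-- A family of bijections is closed under the switchings inside the classes of `cl`. -/
def SwapClosed (cl : A → W) (C : Finset (A ≃ B)) : Prop :=
  ∀ σ ∈ C, ∀ a b, cl a = cl b → (Equiv.swap a b).trans σ ∈ C

/-- A fixed pair is bad for at most a fraction `k / D` of a swap-closed family, where `D` is the
size of the class of the pair. -/
theorem card_class_mul_card_bad_le {cl : A → W} {C : Finset (A ≃ B)} (hC : SwapClosed cl C)
    {row : B → U} {k : ℕ} (hrow : ∀ u, (Finset.univ.filter fun b => row b = u).card ≤ k)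
    {p p' : A} (hpp : p ≠ p') (hcl : cl p = cl p') :
    (Finset.univ.filter fun z => cl z = cl p).card *
      (C.filter fun σ => row (σ p) = row (σ p')).card ≤ 2 * k * C.card := by
  set D := Finset.univ.filter fun z => cl z = cl p with hD
  have hpD : p ∈ D := by simp [hD]
  have hp'D : p' ∈ D := by simp [hD, hcl]
  -- Switching `p'` with `z` shows that every `z` of the class is equally often in the row of `p`;
  -- for a single `σ`, at most `k` half-edges are.
  have h1 : ∀ z ∈ D.erase p, (C.filter fun σ => row (σ p) = row (σ p')).card =
      (C.filter fun σ => row (σ p) = row (σ z)).card := by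
    intro z hz
    rw [Finset.mem_erase] at hz
    have hz' : cl z = cl p := by simpa [hD] using hz.2
    refine Finset.card_bij (fun σ _ => (Equiv.swap p' z).trans σ) ?_ ?_ ?_
    · intro σ hσ
      rw [Finset.mem_filter] at hσ ⊢
      refine ⟨hC σ hσ.1 _ _ (by rw [hz', hcl]), ?_⟩
      simp [Equiv.swap_apply_of_ne_of_ne hpp hz.1.symm, hσ.2]
    · intro σ _ τ _ h
      ext a
      have := congrArg (fun e : A ≃ B => e ((Equiv.swap p' z) a)) h
      simpa using this
    · intro σ hσ
      rw [Finset.mem_filter] at hσ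
      refine ⟨(Equiv.swap p' z).trans σ, ?_, ?_⟩
      · rw [Finset.mem_filter]
        refine ⟨hC σ hσ.1 _ _ (by rw [hz', hcl]), ?_⟩
        simp [Equiv.swap_apply_of_ne_of_ne hpp hz.1.symm, hσ.2]
      · ext a; simp
  have h2 : (D.erase p).card * (C.filter fun σ => row (σ p) = row (σ p')).card ≤ k * C.card := by
    calc (D.erase p).card * (C.filter fun σ => row (σ p) = row (σ p')).card
        = ∑ z ∈ D.erase p, (C.filter fun σ => row (σ p) = row (σ z)).card := by
          rw [← Finset.sum_congr rfl h1, Finset.sum_const, smul_eq_mul]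
      _ = ∑ σ ∈ C, ((D.erase p).filter fun z => row (σ p) = row (σ z)).card := by
          simp only [Finset.card_filter]
          rw [Finset.sum_comm]
      _ ≤ ∑ σ ∈ C, k := by
          refine Finset.sum_le_sum fun σ _ => le_trans (Finset.card_le_card ?_)
            (card_filter_row_eq_le hrow σ (row (σ p)))
          intro z hz
          simp only [Finset.mem_filter, Finset.mem_univ, true_and] at hz ⊢
          exact hz.2.symm
      _ = k * C.card := by simp [mul_comm]
  -- The class contains both `p` and `p'`, so dropping `p` loses at most half of it; hence the
  -- factor `2` in the bound.
  have h3 : D.card ≤ 2 * (D.erase p).card := by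
    have : 0 < (D.erase p).card := Finset.card_pos.2 ⟨p', by simp [hpp.symm, hp'D]⟩
    rw [Finset.card_erase_of_mem hpD] at this ⊢
    omega
  calc _ ≤ 2 * (D.erase p).card * (C.filter fun σ => row (σ p) = row (σ p')).card :=
        Nat.mul_le_mul_right _ h3
    _ ≤ 2 * k * C.card := by rw [mul_assoc, mul_assoc]; exact Nat.mul_le_mul_left _ h2

/-- The mean number of bad pairs in a swap-closed family is at most `2 k l` per class. -/
theorem sum_card_badPairs_le [Fintype W] {cl : A → W} {C : Finset (A ≃ B)} (hC : SwapClosed cl C)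
    {row : B → U} {k : ℕ} (hrow : ∀ u, (Finset.univ.filter fun b => row b = u).card ≤ k)
    {col : A → V} {l : ℕ} (hcol : ∀ v, (Finset.univ.filter fun a => col a = v).card ≤ l)
    (hcc : ∀ a b, col a = col b → cl a = cl b) :
    ∑ σ ∈ C, (badPairs col row σ).card ≤ Fintype.card W * (l * (2 * k * C.card)) := by
  have h1 : ∑ σ ∈ C, (badPairs col row σ).card =
      ∑ w : W, ∑ p ∈ Finset.univ.filter (fun p => cl p = w),
        ∑ p' ∈ Finset.univ.filter (fun p' => p ≠ p' ∧ col p = col p'),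
          (C.filter fun σ => row (σ p) = row (σ p')).card := by
    rw [Finset.sum_fiberwise Finset.univ cl fun p =>
      ∑ p' ∈ Finset.univ.filter (fun p' => p ≠ p' ∧ col p = col p'),
          (C.filter fun σ => row (σ p) = row (σ p')).card]
    simp only [badPairs, Finset.card_filter, Finset.sum_filter]
    rw [Finset.sum_comm, Fintype.sum_prod_type]
    refine Finset.sum_congr rfl fun p _ => Finset.sum_congr rfl fun p' _ => ?_
    by_cases h : p ≠ p' ∧ col p = col p'
    · simp [h]
    · rw [if_neg h]
      refine Finset.sum_eq_zero fun σ _ => if_neg fun h' => h ⟨h'.1, h'.2.1⟩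
  rw [h1]
  have h2 : ∀ w ∈ (Finset.univ : Finset W), ∑ p ∈ Finset.univ.filter (fun p => cl p = w),
        ∑ p' ∈ Finset.univ.filter (fun p' => p ≠ p' ∧ col p = col p'),
          (C.filter fun σ => row (σ p) = row (σ p')).card ≤ l * (2 * k * C.card) := by
    intro w _
    set D := Finset.univ.filter fun z => cl z = w with hD
    rcases D.eq_empty_or_nonempty with h | h
    · simp [h]
    -- The class has `D.card` choices of `p`, and each pair is bad with frequency of order `1 /
    -- D.card`; the size of the class cancels.
    refine Nat.le_of_mul_le_mul_left ?_ (Finset.card_pos.2 h)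
    rw [Finset.mul_sum]
    calc _ ≤ ∑ p ∈ D, l * (2 * k * C.card) := by
          refine Finset.sum_le_sum fun p hp => ?_
          have hpw : cl p = w := by simpa [hD] using hp
          rw [Finset.mul_sum]
          calc _ ≤ ∑ p' ∈ Finset.univ.filter (fun p' => p ≠ p' ∧ col p = col p'),
                2 * k * C.card := by
                refine Finset.sum_le_sum fun p' hp' => ?_
                simp only [Finset.mem_filter, Finset.mem_univ, true_and] at hp'
                have := card_class_mul_card_bad_le hC hrow hp'.1 (hcc _ _ hp'.2)
                rwa [hpw] at this
            _ ≤ l * (2 * k * C.card) := by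
                rw [Finset.sum_const, smul_eq_mul]
                refine Nat.mul_le_mul_right _ (le_trans (Finset.card_le_card ?_) (hcol (col p)))
                intro p' hp'
                simp only [Finset.mem_filter, Finset.mem_univ, true_and] at hp' ⊢
                exact hp'.2.symm
      _ = _ := by simp
  refine (Finset.sum_le_sum h2).trans_eq ?_
  simp

/-- A bad pair can be removed by a switching inside its class. -/
theorem exists_swap_badPairs_lt {cl : A → W} {row : B → U} {k : ℕ}
    (hrow : ∀ u, (Finset.univ.filter fun b => row b = u).card ≤ k)
    {col : A → V} {l : ℕ} (hcol : ∀ v, (Finset.univ.filter fun a => col a = v).card ≤ l)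
    (hbig : ∀ a, 2 * (l * k) < (Finset.univ.filter fun z => cl z = cl a).card)
    (σ : A ≃ B) (hσ : (badPairs col row σ).Nonempty) :
    ∃ a b, cl a = cl b ∧
      (badPairs col row ((Equiv.swap a b).trans σ)).card < (badPairs col row σ).card := by
  obtain ⟨⟨p, p'⟩, hp⟩ := hσ
  have hp0 := hp
  simp only [badPairs, Finset.mem_filter, Finset.mem_univ, true_and] at hp
  obtain ⟨hpp, hcp, hrp⟩ := hp
  -- `X1` holds the half-edges whose partner shares a row with the column of `p`, `X2` those whose
  -- column meets the row of `p`. Switching `p` with a `z` outside both leaves `p` and `z` in no bad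
  -- pair and creates none elsewhere.
  set X1 := (Finset.univ.filter fun a => col a = col p).biUnion
    fun a => Finset.univ.filter fun z => row (σ z) = row (σ a) with hX1
  set X2 := (Finset.univ.filter fun a => row (σ a) = row (σ p)).biUnion
    fun a => Finset.univ.filter fun z => col z = col a with hX2
  have c1 : X1.card ≤ l * k := (Finset.card_biUnion_le_card_mul _ _ k fun a _ =>
    card_filter_row_eq_le hrow σ _).trans (Nat.mul_le_mul_right _ (hcol _))
  have c2 : X2.card ≤ k * l := (Finset.card_biUnion_le_card_mul _ _ l fun a _ =>
    hcol _).trans (Nat.mul_le_mul_right _ (card_filter_row_eq_le hrow σ _))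
  obtain ⟨z, hz, hzX⟩ : ∃ z ∈ Finset.univ.filter (fun z => cl z = cl p), z ∉ X1 ∪ X2 := by
    apply Finset.exists_mem_notMem_of_card_lt_card
    refine ((Finset.card_union_le _ _).trans ?_).trans_lt (hbig p)
    rw [mul_comm k l] at c2
    omega
  simp only [Finset.mem_filter, Finset.mem_univ, true_and] at hz
  simp only [hX1, hX2, Finset.mem_union, Finset.mem_biUnion, Finset.mem_filter, Finset.mem_univ,
    true_and, not_or, not_exists, not_and] at hzX
  obtain ⟨hz1, hz2⟩ := hzX
  have hzp : z ≠ p := fun h => hz1 p rfl (by rw [h])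
  refine ⟨p, z, hz.symm, Finset.card_lt_card ?_⟩
  have hp_fix : ∀ a, col a = col p → a ≠ p →
      row (σ (Equiv.swap p z a)) ≠ row (σ (Equiv.swap p z p)) := by
    intro a ha hap h
    have haz : a ≠ z := fun h' => hz1 a ha (by rw [h'])
    rw [Equiv.swap_apply_of_ne_of_ne hap haz, Equiv.swap_apply_left] at h
    exact hz1 a ha h.symm
  have hz_fix : ∀ a, col a = col z → a ≠ z →
      row (σ (Equiv.swap p z a)) ≠ row (σ (Equiv.swap p z z)) := by
    intro a ha haz h
    have hap : a ≠ p := fun h' => hz2 p rfl (by rw [← ha, h'])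
    rw [Equiv.swap_apply_of_ne_of_ne hap haz, Equiv.swap_apply_right] at h
    exact hz2 a h ha.symm
  have key : ∀ a b, (a, b) ∈ badPairs col row ((Equiv.swap p z).trans σ) →
      a ≠ p ∧ a ≠ z ∧ b ≠ p ∧ b ≠ z := by
    intro a b hab
    simp only [mem_badPairs, Equiv.trans_apply] at hab
    obtain ⟨h1, h2, h3⟩ := hab
    refine ⟨?_, ?_, ?_, ?_⟩
    · rintro rfl; exact hp_fix b h2.symm h1.symm h3.symm
    · rintro rfl; exact hz_fix b h2.symm h1.symm h3.symm
    · rintro rfl; exact hp_fix a h2 h1 h3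
    · rintro rfl; exact hz_fix a h2 h1 h3
  rw [Finset.ssubset_iff_of_subset]
  · exact ⟨(p, p'), hp0, fun h => (key _ _ h).1 rfl⟩
  · rintro ⟨a, b⟩ hab
    obtain ⟨h1, h2, h3, h4⟩ := key a b hab
    simp only [mem_badPairs, Equiv.trans_apply,
      Equiv.swap_apply_of_ne_of_ne h1 h2, Equiv.swap_apply_of_ne_of_ne h3 h4] at hab ⊢
    exact hab

/-- If the classes are large, a fraction of at least `1 / (2 |A| ^ (2 K))` of a swap-closed family
consists of bijections without bad pairs. -/
theorem card_le_mul_card_simple [Fintype W] [Nonempty A] {cl : A → W} {C : Finset (A ≃ B)}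
    (hC : SwapClosed cl C)
    {row : B → U} {k : ℕ} (hrow : ∀ u, (Finset.univ.filter fun b => row b = u).card ≤ k)
    {col : A → V} {l : ℕ} (hcol : ∀ v, (Finset.univ.filter fun a => col a = v).card ≤ l)
    (hcc : ∀ a b, col a = col b → cl a = cl b)
    (hbig : ∀ a, 2 * (l * k) < (Finset.univ.filter fun z => cl z = cl a).card) :
    C.card ≤ 2 * (Fintype.card A ^ 2) ^ (4 * Fintype.card W * (l * k)) *
      (C.filter fun σ => badPairs col row σ = ∅).card := by
  classical
  -- The threshold is twice the bound on the mean number of bad pairs, so that Markov's inequality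
  -- keeps half of the family. It does not depend on the size of `A`.
  set K := 4 * Fintype.card W * (l * k) with hK
  -- A bijection with at most `j + 1` bad pairs is one switching away from one with at most `j`.
  -- There are at most `Fintype.card A ^ 2` switchings, and this factor is lost at each step.
  have hstep : ∀ j, (C.filter fun σ => (badPairs col row σ).card ≤ j).card ≤
      (Fintype.card A ^ 2) ^ j * (C.filter fun σ => badPairs col row σ = ∅).card := by
    intro j
    induction j with
    | zero => simp
    | succ j ih =>
      have hsub : (C.filter fun σ => (badPairs col row σ).card ≤ j + 1) ⊆
          ((Finset.univ : Finset (A × A)) ×ˢ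
            (C.filter fun σ => (badPairs col row σ).card ≤ j)).image
            (fun x => (Equiv.swap x.1.1 x.1.2).trans x.2) := by
        intro σ hσ
        rw [Finset.mem_filter] at hσ
        simp only [Finset.mem_image, Finset.mem_product, Finset.mem_univ, true_and,
          Finset.mem_filter]
        rcases (badPairs col row σ).eq_empty_or_nonempty with h | h
        · obtain ⟨a⟩ := ‹Nonempty A›
          -- With no bad pair left, the trivial switching of `a` with itself serves.
          exact ⟨((a, a), σ), ⟨hσ.1, by simp [h]⟩, by ext c; simp⟩
        · obtain ⟨a, b, hab, hlt⟩ := exists_swap_badPairs_lt hrow hcol hbig σ h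
          exact ⟨((a, b), (Equiv.swap a b).trans σ), ⟨hC σ hσ.1 a b hab, by simp only; omega⟩,
            by ext c; simp⟩
      calc _ ≤ _ := Finset.card_le_card hsub
        _ ≤ _ := Finset.card_image_le
        _ = Fintype.card A ^ 2 * (C.filter fun σ => (badPairs col row σ).card ≤ j).card := by
          rw [Finset.card_product, Finset.card_univ, Fintype.card_prod, sq]
        _ ≤ Fintype.card A ^ 2 * ((Fintype.card A ^ 2) ^ j *
            (C.filter fun σ => badPairs col row σ = ∅).card) := Nat.mul_le_mul_left _ ih
        _ = _ := by ring
  have hmarkov : C.card ≤ 2 * (C.filter fun σ => (badPairs col row σ).card ≤ K).card := by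
    have h1 := sum_card_badPairs_le hC hrow hcol hcc
    have h2 : (K + 1) * (C.filter fun σ => ¬ (badPairs col row σ).card ≤ K).card ≤
        ∑ σ ∈ C, (badPairs col row σ).card := by
      calc _ = ∑ σ ∈ C.filter (fun σ => ¬ (badPairs col row σ).card ≤ K), (K + 1) := by
            simp [mul_comm]
        _ ≤ ∑ σ ∈ C.filter (fun σ => ¬ (badPairs col row σ).card ≤ K),
            (badPairs col row σ).card := by
            refine Finset.sum_le_sum fun σ hσ => ?_
            have := (Finset.mem_filter.1 hσ).2
            omega
        _ ≤ _ := Finset.sum_le_sum_of_subset (Finset.filter_subset _ _)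
    have h3 := Finset.card_filter_add_card_filter_not (s := C)
      (fun σ => (badPairs col row σ).card ≤ K)
    have h4 : 2 * (Fintype.card W * (l * (2 * k * C.card))) = K * C.card := by
      rw [hK]; ring
    have h5 : 2 * ((K + 1) * (C.filter fun σ => ¬ (badPairs col row σ).card ≤ K).card) ≤
        (K + 1) * C.card := by
      have : K * C.card ≤ (K + 1) * C.card := Nat.mul_le_mul_right _ (Nat.le_succ _)
      omega
    have h6 : 2 * (C.filter fun σ => ¬ (badPairs col row σ).card ≤ K).card ≤ C.card :=
      Nat.le_of_mul_le_mul_left (by linarith) (Nat.succ_pos K)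
    omega
  calc C.card ≤ _ := hmarkov
    _ ≤ _ := Nat.mul_le_mul_left 2 (hstep K)
    _ = _ := by ring

end Switching

/-! ### Configurations and their parity-check matrices -/

section Configurations

/-- The configurations: pairings of the half-edges at the columns with those at the rows. -/
abbrev Config (ℓ m r n : ℕ) : Type := (Fin n × Fin ℓ) ≃ (Fin r × Fin m)

variable {ℓ m r n : ℕ}

/-- The configurations without multiple edges. -/
def IsSimple (σ : Config ℓ m r n) : Prop := ∀ j, Function.Injective fun a => (σ (j, a)).1

theorem badPairs_eq_empty_iff {σ : Config ℓ m r n} :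
    badPairs Prod.fst Prod.fst σ = ∅ ↔ IsSimple σ := by
  constructor
  · intro h j a b hab
    by_contra hne
    have : ((j, a), (j, b)) ∈ badPairs Prod.fst Prod.fst σ :=
      mem_badPairs.2 ⟨by simpa using hne, rfl, hab⟩
    simp [h] at this
  · intro h
    refine Finset.eq_empty_of_forall_notMem ?_
    rintro ⟨⟨j, a⟩, ⟨k, b⟩⟩ hp
    obtain ⟨h1, h2, h3⟩ := mem_badPairs.1 hp
    obtain rfl : j = k := h2
    exact h1 (by rw [h j h3])

/-- The parity-check matrix of a configuration. -/
def matrixOf (σ : Config ℓ m r n) : Matrix (Fin r) (Fin n) (ZMod 2) :=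
  fun i j => if ∃ a, (σ (j, a)).1 = i then 1 else 0

theorem matrixOf_ne_zero {σ : Config ℓ m r n} {i : Fin r} {j : Fin n} :
    matrixOf σ i j ≠ 0 ↔ ∃ a, (σ (j, a)).1 = i := by
  unfold matrixOf
  split_ifs with h <;> simpa using h

/-- The half-edges at a column of a simple configuration enumerate its neighbouring rows. -/
noncomputable def colEquiv {σ : Config ℓ m r n} (hσ : IsSimple σ) (j : Fin n) :
    Fin ℓ ≃ {i // matrixOf σ i j ≠ 0} :=
  Equiv.ofBijective (fun a => ⟨(σ (j, a)).1, matrixOf_ne_zero.2 ⟨a, rfl⟩⟩)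
    ⟨fun a b h => hσ j (congrArg Subtype.val h), fun ⟨i, hi⟩ => by
      obtain ⟨a, ha⟩ := matrixOf_ne_zero.1 hi
      exact ⟨a, Subtype.ext ha⟩⟩

/-- The half-edges at a row of a simple configuration enumerate its neighbouring columns. -/
noncomputable def rowEquiv {σ : Config ℓ m r n} (hσ : IsSimple σ) (i : Fin r) :
    Fin m ≃ {j // matrixOf σ i j ≠ 0} :=
  Equiv.ofBijective (fun b => ⟨(σ.symm (i, b)).1,
      matrixOf_ne_zero.2 ⟨(σ.symm (i, b)).2, by simp⟩⟩)
    ⟨fun b c h => by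
      have h1 : (σ.symm (i, b)).1 = (σ.symm (i, c)).1 := congrArg Subtype.val h
      have h2 : (σ.symm (i, b)).2 = (σ.symm (i, c)).2 := by
        refine hσ (σ.symm (i, b)).1 ?_
        simp only [Prod.mk.eta, Equiv.apply_symm_apply]
        rw [h1]
        simp
      have h3 := σ.symm.injective (Prod.ext h1 h2)
      exact (Prod.ext_iff.1 h3).2, fun ⟨j, hj⟩ => by
      obtain ⟨a, ha⟩ := matrixOf_ne_zero.1 hj
      refine ⟨(σ (j, a)).2, Subtype.ext ?_⟩
      have : (i, (σ (j, a)).2) = σ (j, a) := Prod.ext ha.symm rfl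
      simp [this]⟩

/-- The configuration given by an enumeration of the ones in each column and in each row. -/
def pairingOf (H : Matrix (Fin r) (Fin n) (ZMod 2))
    (c : ∀ j, Fin ℓ ≃ {i // H i j ≠ 0}) (d : ∀ i, Fin m ≃ {j // H i j ≠ 0}) :
    Config ℓ m r n where
  toFun x := ((c x.1 x.2).1, (d (c x.1 x.2).1).symm ⟨x.1, (c x.1 x.2).2⟩)
  invFun y := ((d y.1 y.2).1, (c (d y.1 y.2).1).symm ⟨y.1, (d y.1 y.2).2⟩)
  left_inv := by
    rintro ⟨j, a⟩
    -- The second coordinate involves `c` at a column that is only propositionally `j`; it is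
    -- generalised to `j'` so that the equality can be substituted.
    have h : ∀ j' (_ : j' = j) p, (c j').symm ⟨(c j a).1, p⟩ = a := by
      rintro _ rfl p; simp
    have h' : (d (c j a).1 ((d (c j a).1).symm ⟨j, (c j a).2⟩)).1 = j := by
      rw [Equiv.apply_symm_apply]
    exact Prod.ext h' (h _ h' _)
  right_inv := by
    rintro ⟨i, b⟩
    have h : ∀ i' (_ : i' = i) p, (d i').symm ⟨(d i b).1, p⟩ = b := by
      rintro _ rfl p; simp
    have h' : (c (d i b).1 ((c (d i b).1).symm ⟨i, (d i b).2⟩)).1 = i := by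
      rw [Equiv.apply_symm_apply]
    exact Prod.ext h' (h _ h' _)

theorem pairingOf_isSimple (H : Matrix (Fin r) (Fin n) (ZMod 2))
    (c : ∀ j, Fin ℓ ≃ {i // H i j ≠ 0}) (d : ∀ i, Fin m ≃ {j // H i j ≠ 0}) :
    IsSimple (pairingOf H c d) := fun j _ _ h => (c j).injective (Subtype.ext h)

theorem matrixOf_pairingOf (H : Matrix (Fin r) (Fin n) (ZMod 2))
    (c : ∀ j, Fin ℓ ≃ {i // H i j ≠ 0}) (d : ∀ i, Fin m ≃ {j // H i j ≠ 0}) :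
    matrixOf (pairingOf H c d) = H := by
  ext i j
  have h : (∃ a, ((pairingOf H c d) (j, a)).1 = i) ↔ H i j ≠ 0 := by
    constructor
    · rintro ⟨a, rfl⟩
      exact (c j a).2
    · intro hi
      exact ⟨(c j).symm ⟨i, hi⟩, by simp [pairingOf]⟩
  unfold matrixOf
  split_ifs with h'
  · have := h.1 h'
    revert this
    generalize H i j = z
    revert z
    decide
  · exact (not_not.1 (mt h.2 h')).symm

/-- The simple configurations with a given matrix correspond to the enumerations of the ones in
its columns and rows. -/
noncomputable def simpleConfigEquiv (H : Matrix (Fin r) (Fin n) (ZMod 2)) :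
    {σ : Config ℓ m r n // IsSimple σ ∧ matrixOf σ = H} ≃
      (∀ j, Fin ℓ ≃ {i // H i j ≠ 0}) × (∀ i, Fin m ≃ {j // H i j ≠ 0}) where
  toFun σ := σ.2.2 ▸ (colEquiv σ.2.1, rowEquiv σ.2.1)
  invFun x := ⟨pairingOf H x.1 x.2, pairingOf_isSimple H x.1 x.2, matrixOf_pairingOf H x.1 x.2⟩
  left_inv := by
    rintro ⟨σ, hσ, rfl⟩
    refine Subtype.ext (Equiv.ext ?_)
    rintro ⟨j, a⟩
    refine Prod.ext rfl ?_
    change (rowEquiv hσ (σ (j, a)).1).symm ⟨j, _⟩ = (σ (j, a)).2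
    rw [Equiv.symm_apply_eq]
    refine Subtype.ext ?_
    change j = (σ.symm ((σ (j, a)).1, (σ (j, a)).2)).1
    simp
  right_inv := by
    rintro ⟨c, d⟩
    -- `toFun` transports along `matrixOf σ = H`. With a variable matrix the cast disappears, and
    -- enumerations can be compared by their underlying values.
    have key : ∀ (H' : Matrix (Fin r) (Fin n) (ZMod 2)) (h : H' = H)
        (x : (∀ j, Fin ℓ ≃ {i // H' i j ≠ 0}) × (∀ i, Fin m ≃ {j // H' i j ≠ 0})),
        (∀ j a, (x.1 j a).1 = (c j a).1) → (∀ i b, (x.2 i b).1 = (d i b).1) →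
        (h ▸ x : (∀ j, Fin ℓ ≃ {i // H i j ≠ 0}) × (∀ i, Fin m ≃ {j // H i j ≠ 0})) = (c, d) := by
      rintro _ rfl ⟨c', d'⟩ h1 h2
      refine Prod.ext ?_ ?_
      · funext j; ext a; exact congrArg Fin.val (h1 j a)
      · funext i; ext b; exact congrArg Fin.val (h2 i b)
    refine key _ _ _ ?_ ?_
    · intro j a; rfl
    · intro i b; rfl

theorem hammingNorm_eq_card {ι : Type*} [Fintype ι] (x : ι → ZMod 2) :
    hammingNorm x = Fintype.card {i // x i ≠ 0} := by
  rw [hammingNorm, Fintype.card_subtype]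

theorem matrixOf_mem_ensemble {σ : Config ℓ m r n} (hσ : IsSimple σ) :
    matrixOf σ ∈ ensemble ℓ m r n := by
  simp only [ensemble, Finset.mem_filter, Finset.mem_univ, true_and]
  refine ⟨fun j => ?_, fun i => ?_⟩
  · rw [hammingNorm_eq_card, ← Fintype.card_congr (colEquiv hσ j), Fintype.card_fin]
  · rw [hammingNorm_eq_card, ← Fintype.card_congr (rowEquiv hσ i), Fintype.card_fin]

-- The count does not depend on `H`, so a uniform simple configuration induces the uniform
-- distribution on the ensemble.
open Classical in
theorem card_simple_matrixOf_eq {H : Matrix (Fin r) (Fin n) (ZMod 2)}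
    (hH : H ∈ ensemble ℓ m r n) :
    (Finset.univ.filter fun σ : Config ℓ m r n => IsSimple σ ∧ matrixOf σ = H).card =
      ℓ.factorial ^ n * m.factorial ^ r := by
  simp only [ensemble, Finset.mem_filter, Finset.mem_univ, true_and] at hH
  obtain ⟨h1, h2⟩ := hH
  rw [← Fintype.card_subtype, Fintype.card_congr (simpleConfigEquiv H), Fintype.card_prod,
    Fintype.card_pi, Fintype.card_pi]
  congr 1
  · rw [Finset.prod_congr rfl (g := fun _ => ℓ.factorial), Finset.prod_const, Finset.card_univ,
      Fintype.card_fin]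
    intro j _
    have : Fintype.card (Fin ℓ) = Fintype.card {i // H i j ≠ 0} := by
      rw [← hammingNorm_eq_card (fun i => H i j), h1 j, Fintype.card_fin]
    exact (Fintype.card_equiv (Fintype.equivOfCardEq this)).trans (by rw [Fintype.card_fin])
  · rw [Finset.prod_congr rfl (g := fun _ => m.factorial), Finset.prod_const, Finset.card_univ,
      Fintype.card_fin]
    intro i _
    have : Fintype.card (Fin m) = Fintype.card {j // H i j ≠ 0} := by
      rw [← hammingNorm_eq_card (fun j => H i j), h2 i, Fintype.card_fin]
    refine Eq.trans ?_
      ((Fintype.card_equiv (Fintype.equivOfCardEq this)).trans (by rw [Fintype.card_fin]))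
    convert rfl

open Classical in
theorem card_simple_filter (P : Matrix (Fin r) (Fin n) (ZMod 2) → Prop) :
    (Finset.univ.filter fun σ : Config ℓ m r n => IsSimple σ ∧ P (matrixOf σ)).card =
      ((ensemble ℓ m r n).filter P).card * (ℓ.factorial ^ n * m.factorial ^ r) := by
  rw [Finset.card_eq_sum_card_fiberwise (f := matrixOf) (t := (ensemble ℓ m r n).filter P)]
  · rw [Finset.sum_congr rfl (g := fun _ => ℓ.factorial ^ n * m.factorial ^ r), Finset.sum_const,
      smul_eq_mul]
    intro H hH
    rw [Finset.mem_filter] at hH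
    rw [← card_simple_matrixOf_eq hH.1, Finset.filter_filter]
    congr 1
    ext σ
    simp only [Finset.mem_filter, Finset.mem_univ, true_and]
    constructor
    · rintro ⟨⟨h1, _⟩, h2⟩; exact ⟨h1, h2⟩
    · rintro ⟨h1, rfl⟩; exact ⟨⟨h1, hH.2⟩, rfl⟩
  · intro σ hσ
    have := (Finset.mem_filter.1 hσ).2
    exact Finset.mem_coe.2 (Finset.mem_filter.2 ⟨matrixOf_mem_ensemble this.1, this.2⟩)

/-- Every row of `H` has an even number of ones in the columns `T`. -/
def EvenOn (T : Finset (Fin n)) (H : Matrix (Fin r) (Fin n) (ZMod 2)) : Prop :=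
  ∀ i, Even (T.filter fun j => H i j ≠ 0).card

/-- The configurations in which every row has an even number of partners in the columns `T`. -/
noncomputable def evenConfigs (ℓ m r : ℕ) (T : Finset (Fin n)) : Finset (Config ℓ m r n) :=
  Finset.univ.filter fun σ => ∀ i, Even (Finset.univ.filter fun b => (σ.symm (i, b)).1 ∈ T).card

theorem evenOn_matrixOf_iff {σ : Config ℓ m r n} (hσ : IsSimple σ) (T : Finset (Fin n)) :
    EvenOn T (matrixOf σ) ↔ σ ∈ evenConfigs ℓ m r T := by
  simp only [EvenOn, evenConfigs, Finset.mem_filter, Finset.mem_univ, true_and]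
  refine forall_congr' fun i => ?_
  rw [show (T.filter fun j => matrixOf σ i j ≠ 0).card =
    (Finset.univ.filter fun b => (σ.symm (i, b)).1 ∈ T).card from ?_]
  symm
  refine Finset.card_bij (fun b _ => (rowEquiv hσ i b).1) ?_ ?_ ?_
  · intro b hb
    rw [Finset.mem_filter] at hb ⊢
    exact ⟨hb.2, (rowEquiv hσ i b).2⟩
  · intro b _ c _ h
    exact (rowEquiv hσ i).injective (Subtype.ext h)
  · intro j hj
    rw [Finset.mem_filter] at hj
    have h : (rowEquiv hσ i ((rowEquiv hσ i).symm ⟨j, hj.2⟩)).1 = j := by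
      rw [Equiv.apply_symm_apply]
    refine ⟨(rowEquiv hσ i).symm ⟨j, hj.2⟩, ?_, h⟩
    rw [Finset.mem_filter]
    refine ⟨Finset.mem_univ _, ?_⟩
    have h2 : (σ.symm (i, (rowEquiv hσ i).symm ⟨j, hj.2⟩)).1 = j := h
    rw [h2]
    exact hj.1

/-- Switching two half-edges that are both in `T` or both outside it leaves unchanged the set of row
half-edges matched to `T`. -/
theorem swapClosed_evenConfigs (T : Finset (Fin n)) :
    SwapClosed (fun x : Fin n × Fin ℓ => decide (x.1 ∈ T)) (evenConfigs ℓ m r T) := by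
  intro σ hσ x y hxy
  have hxy' : x.1 ∈ T ↔ y.1 ∈ T := by simpa using hxy
  simp only [evenConfigs, Finset.mem_filter, Finset.mem_univ, true_and] at hσ ⊢
  intro i
  have h : ∀ z, (Equiv.swap x y z).1 ∈ T ↔ z.1 ∈ T := by
    intro z
    rw [Equiv.swap_apply_def]
    split_ifs with h1 h2
    · rw [h1, hxy']
    · rw [h2, hxy']
    · rfl
  change Even (Finset.univ.filter fun b => (Equiv.swap x y (σ.symm (i, b))).1 ∈ T).card
  rw [Finset.filter_congr (q := fun b => (σ.symm (i, b)).1 ∈ T) fun b _ => h (σ.symm (i, b))]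
  exact hσ i

open Classical in
/-- The number of matrices of the ensemble with even rows on `T`, up to a polynomial factor and
a factor which does not depend on `T`. -/
theorem card_evenOn_bounds (T : Finset (Fin n)) (hne : 0 < n * ℓ)
    (h1 : ∀ j ∈ T, 2 * (ℓ * m) < T.card * ℓ) (h2 : ∀ j ∉ T, 2 * (ℓ * m) < (n - T.card) * ℓ) :
    (evenConfigs ℓ m r T).card ≤ 2 * ((n * ℓ) ^ 2) ^ (8 * (ℓ * m)) *
      (((ensemble ℓ m r n).filter (EvenOn T)).card * (ℓ.factorial ^ n * m.factorial ^ r)) := by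
  have hcard : ∀ k l : ℕ, ∀ u : Fin k,
      (Finset.univ.filter fun b : Fin k × Fin l => b.1 = u).card ≤ l := by
    intro k l u
    have : (Finset.univ.filter fun b : Fin k × Fin l => b.1 = u) =
        {u} ×ˢ (Finset.univ : Finset (Fin l)) := by
      ext ⟨a, b⟩; simp [eq_comm]
    rw [this]; simp
  have : Nonempty (Fin n × Fin ℓ) := Fintype.card_pos_iff.1 (by simpa using hne)
  -- The two classes, `T` and its complement, turn the constant `4 * Fintype.card W` into `8`. An
  -- empty class imposes no size condition, so `T = ∅` is allowed.
  have key := card_le_mul_card_simple (swapClosed_evenConfigs (ℓ := ℓ) (m := m) (r := r) T)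
    (hcard r m) (hcard n ℓ) (fun a b h => by simp [h]) (fun a => by
      by_cases ha : a.1 ∈ T
      · have : (Finset.univ.filter fun z : Fin n × Fin ℓ => decide (z.1 ∈ T) = decide (a.1 ∈ T)) =
            T ×ˢ (Finset.univ : Finset (Fin ℓ)) := by
          ext z; simp [ha]
        rw [this]
        simpa using h1 _ ha
      · have : (Finset.univ.filter fun z : Fin n × Fin ℓ => decide (z.1 ∈ T) = decide (a.1 ∈ T)) =
            Tᶜ ×ˢ (Finset.univ : Finset (Fin ℓ)) := by
          ext z; simp [ha]
        rw [this]
        simpa [Finset.card_compl] using h2 _ ha)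
  rw [← card_simple_filter]
  convert key using 2
  · simp
  · congr 1
    ext σ
    simp only [Finset.mem_filter, Finset.mem_univ, true_and, badPairs_eq_empty_iff]
    constructor
    · rintro ⟨h1, h2⟩; exact ⟨(evenOn_matrixOf_iff h1 T).1 h2, h1⟩
    · rintro ⟨h1, h2⟩; exact ⟨h2, (evenOn_matrixOf_iff h2 T).2 h1⟩

open Classical in
theorem card_evenOn_le (T : Finset (Fin n)) :
    ((ensemble ℓ m r n).filter (EvenOn T)).card * (ℓ.factorial ^ n * m.factorial ^ r) ≤
      (evenConfigs ℓ m r T).card := by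
  rw [← card_simple_filter]
  refine Finset.card_le_card fun σ hσ => ?_
  simp only [Finset.mem_filter, Finset.mem_univ, true_and] at hσ
  exact (evenOn_matrixOf_iff hσ.1 T).1 hσ.2

end Configurations

/-! ### Probability of a codeword, and the mean as a sum over supports -/

section Counting

open Classical in
/-- The image of a fixed set under a random bijection is a random set of the same size. -/
theorem card_equiv_map_mul_choose {A B : Type*} [Fintype A] [DecidableEq A] [Fintype B]
    [DecidableEq B] (hAB : Fintype.card A = Fintype.card B) (X : Finset A)
    (P : Finset B → Prop) :
    (Finset.univ.filter fun σ : A ≃ B => P (X.map σ.toEmbedding)).card *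
        (Fintype.card B).choose X.card =
      ((Finset.powersetCard X.card Finset.univ).filter P).card * (Fintype.card B).factorial := by
  set σ₀ := Fintype.equivOfCardEq hAB
  set F := (Finset.univ.filter fun σ : A ≃ B => X.map σ.toEmbedding = X.map σ₀.toEmbedding).card
    with hF
  -- A permutation of `B` carrying the reference image to `S` identifies the two fibres, so all
  -- fibres have size `F`; taking `P` to be `True` later eliminates `F`.
  have hfib : ∀ S ∈ Finset.powersetCard X.card (Finset.univ : Finset B),
      (Finset.univ.filter fun σ : A ≃ B => X.map σ.toEmbedding = S).card = F := by
    intro S hS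
    have hS' : Fintype.card {b // b ∈ X.map σ₀.toEmbedding} = Fintype.card {b // b ∈ S} := by
      rw [Fintype.card_coe, Fintype.card_coe, Finset.card_map, (Finset.mem_powersetCard.1 hS).2]
    set π : B ≃ B := (Fintype.equivOfCardEq hS').extendSubtype with hπ
    have hπS : (X.map σ₀.toEmbedding).map π.toEmbedding = S := by
      refine Finset.eq_of_subset_of_card_le ?_ ?_
      · intro b hb
        obtain ⟨a, ha, rfl⟩ := Finset.mem_map.1 hb
        exact Equiv.extendSubtype_mem _ a ha
      · simp [(Finset.mem_powersetCard.1 hS).2]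
    symm
    refine Finset.card_bij (fun σ _ => σ.trans π) ?_ ?_ ?_
    · intro σ hσ
      simp only [Finset.mem_filter, Finset.mem_univ, true_and] at hσ ⊢
      rw [← hπS, ← hσ, Finset.map_map]
      rfl
    · intro σ _ τ _ h
      ext a
      have := congrArg (fun e : A ≃ B => π.symm (e a)) h
      simpa using this
    · intro σ hσ
      simp only [Finset.mem_filter, Finset.mem_univ, true_and] at hσ
      refine ⟨σ.trans π.symm, ?_, by ext a; simp⟩
      simp only [Finset.mem_filter, Finset.mem_univ, true_and]
      refine (Finset.map_injective π.toEmbedding) ?_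
      rw [hπS, ← hσ, Finset.map_map]
      congr 1
      ext a; simp
  have hsum : ∀ P : Finset B → Prop,
      (Finset.univ.filter fun σ : A ≃ B => P (X.map σ.toEmbedding)).card =
        ((Finset.powersetCard X.card Finset.univ).filter P).card * F := by
    intro P
    rw [Finset.card_eq_sum_card_fiberwise (f := fun σ : A ≃ B => X.map σ.toEmbedding)
      (t := (Finset.powersetCard X.card Finset.univ).filter P)]
    · rw [Finset.sum_congr rfl (g := fun _ => F), Finset.sum_const, smul_eq_mul]
      intro S hS
      rw [Finset.mem_filter] at hS
      rw [← hfib S hS.1, Finset.filter_filter]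
      congr 1
      ext σ
      simp only [Finset.mem_filter, Finset.mem_univ, true_and]
      constructor
      · rintro ⟨_, h⟩; exact h
      · rintro rfl; exact ⟨hS.2, rfl⟩
    · intro σ hσ
      have := (Finset.mem_filter.1 hσ).2
      refine Finset.mem_coe.2 (Finset.mem_filter.2 ⟨?_, this⟩)
      simp [Finset.mem_powersetCard]
  have htot := hsum fun _ => True
  simp only [Finset.filter_true, Finset.card_univ, Fintype.card_equiv σ₀,
    Finset.card_powersetCard] at htot
  rw [hsum P, ← hAB, htot, hAB]
  ring

/-- The number of ways to choose an even subset of each of `r` sets of size `m`, of total size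
`v`. -/
def evenCount (r m v : ℕ) : ℕ :=
  (Finset.univ.filter fun f : Fin r → Finset (Fin m) =>
    (∀ i, Even (f i).card) ∧ ∑ i, (f i).card = v).card

theorem card_powersetCard_filter_even (r m v : ℕ) :
    ((Finset.powersetCard v (Finset.univ : Finset (Fin r × Fin m))).filter fun S =>
      ∀ i, Even (Finset.univ.filter fun b => (i, b) ∈ S).card).card = evenCount r m v := by
  have hcard : ∀ S : Finset (Fin r × Fin m),
      ∑ i, (Finset.univ.filter fun b => (i, b) ∈ S).card = S.card := by
    intro S
    simp only [Finset.card_filter]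
    rw [← Fintype.sum_prod_type' (fun i b => if (i, b) ∈ S then 1 else 0)]
    simp
  refine Finset.card_bij (fun S _ i => Finset.univ.filter fun b => (i, b) ∈ S) ?_ ?_ ?_
  · intro S hS
    simp only [Finset.mem_filter, Finset.mem_powersetCard, Finset.mem_univ, true_and] at hS ⊢
    exact ⟨hS.2, (hcard S).trans hS.1.2⟩
  · intro S _ S' _ h
    ext ⟨i, b⟩
    have := congrArg (b ∈ ·) (congrFun h i)
    simpa using this
  · intro f hf
    simp only [Finset.mem_filter, Finset.mem_univ, true_and] at hf
    set S := Finset.univ.filter fun x : Fin r × Fin m => x.2 ∈ f x.1 with hS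
    have h : ∀ i, (Finset.univ.filter fun b => (i, b) ∈ S) = f i := by
      intro i; ext b; simp [hS]
    refine ⟨S, ?_, funext h⟩
    simp only [Finset.mem_filter, Finset.mem_powersetCard, Finset.subset_univ, true_and, h]
    refine ⟨?_, hf.1⟩
    rw [← hcard S, ← hf.2]
    exact Finset.sum_congr rfl fun i _ => by rw [h]

variable {ℓ m r n : ℕ}

/-- Evenness depends only on the image of the half-edges at `T`, a uniform set of `T.card * ℓ` row
half-edges; among such sets `evenCount` counts the even ones. -/
theorem card_evenConfigs_mul_choose (hr : n * ℓ = r * m) (T : Finset (Fin n)) :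
    (evenConfigs ℓ m r T).card * (r * m).choose (T.card * ℓ) =
      evenCount r m (T.card * ℓ) * (r * m).factorial := by
  have h := card_equiv_map_mul_choose (A := Fin n × Fin ℓ) (B := Fin r × Fin m)
    (by simpa using hr) (T ×ˢ Finset.univ)
    (fun S => ∀ i, Even (Finset.univ.filter fun b => (i, b) ∈ S).card)
  simp only [Fintype.card_prod, Fintype.card_fin, Finset.card_product, Finset.card_univ] at h
  rw [← card_powersetCard_filter_even]
  convert h using 2
  · unfold evenConfigs
    congr 1
    ext σ
    simp only [Finset.mem_filter, Finset.mem_univ, true_and]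
    refine forall_congr' fun i => ?_
    have : (Finset.univ.filter fun b => (σ.symm (i, b)).1 ∈ T) =
        Finset.univ.filter fun b => (i, b) ∈
          (T ×ˢ (Finset.univ : Finset (Fin ℓ))).map σ.toEmbedding := by
      ext b
      simp [Finset.mem_map_equiv]
    rw [this]
  · congr 1
    ext S
    simp

theorem evenOn_empty (H : Matrix (Fin r) (Fin n) (ZMod 2)) : EvenOn ∅ H := by
  intro i; simp

theorem card_evenConfigs_empty (hr : n * ℓ = r * m) :
    (evenConfigs ℓ m r (∅ : Finset (Fin n))).card = (r * m).factorial := by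
  have h : evenConfigs ℓ m r (∅ : Finset (Fin n)) = Finset.univ := by
    ext σ; simp [evenConfigs]
  have hc : Fintype.card (Fin n × Fin ℓ) = Fintype.card (Fin r × Fin m) := by simpa using hr
  rw [h, Finset.card_univ, Fintype.card_equiv (Fintype.equivOfCardEq hc), hc]
  simp

/-- The polynomial factor lost by restricting to simple configurations. -/
def polyLoss (ℓ m n : ℕ) : ℕ := 2 * ((n * ℓ) ^ 2) ^ (8 * (ℓ * m))

open Classical in
/-- The number of parity-check matrices of the ensemble for which the indicator of `T` is a
codeword. -/
noncomputable def numEvenOn (ℓ m r : ℕ) {n : ℕ} (T : Finset (Fin n)) : ℕ :=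
  ((ensemble ℓ m r n).filter (EvenOn T)).card

/-- The case `T = ∅` of the switching bound, where every configuration is even: it shows that the
ensemble is nonempty and large enough to serve as a denominator. -/
theorem factorial_le_card_ensemble (hr : n * ℓ = r * m) (hℓ : 0 < ℓ) (hn : 2 * m < n) :
    (r * m).factorial ≤ polyLoss ℓ m n *
      ((ensemble ℓ m r n).card * (ℓ.factorial ^ n * m.factorial ^ r)) := by
  classical
  have h := card_evenOn_bounds (ℓ := ℓ) (m := m) (r := r) (∅ : Finset (Fin n))
    (Nat.mul_pos (by omega) hℓ) (by simp) (fun j _ => by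
      rw [Finset.card_empty, Nat.sub_zero, mul_comm ℓ m, ← mul_assoc]
      exact Nat.mul_lt_mul_of_pos_right hn hℓ)
  rw [card_evenConfigs_empty hr, Finset.filter_true_of_mem fun H _ => evenOn_empty H] at h
  exact h

theorem ensemble_nonempty (hr : n * ℓ = r * m) (hℓ : 0 < ℓ) (hn : 2 * m < n) :
    (ensemble ℓ m r n).Nonempty := by
  rw [← Finset.card_pos]
  by_contra! h
  have h1 := factorial_le_card_ensemble hr hℓ hn
  have h2 := Nat.factorial_pos (r * m)
  simp only [nonpos_iff_eq_zero.1 h, zero_mul, mul_zero] at h1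
  omega

theorem choose_pos_of_subset (hr : n * ℓ = r * m) (T : Finset (Fin n)) :
    0 < (r * m).choose (T.card * ℓ) := by
  refine Nat.choose_pos ?_
  rw [← hr]
  exact Nat.mul_le_mul_right _ (by simpa using Finset.card_le_univ T)

/-- The numerator is bounded by all even configurations, simple or not; switching is needed only for
the denominator, so no condition on `T` arises. -/
theorem numEvenOn_div_le (hr : n * ℓ = r * m) (hℓ : 0 < ℓ) (hn : 2 * m < n)
    (T : Finset (Fin n)) :
    (numEvenOn ℓ m r T : ℝ) / (ensemble ℓ m r n).card ≤
      polyLoss ℓ m n * (evenCount r m (T.card * ℓ) / (r * m).choose (T.card * ℓ)) := by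
  have h1 := factorial_le_card_ensemble hr hℓ hn
  have h2 : numEvenOn ℓ m r T * (ℓ.factorial ^ n * m.factorial ^ r) ≤ _ := card_evenOn_le T
  have h3 := card_evenConfigs_mul_choose hr T
  have h4 := choose_pos_of_subset hr T
  have h5 := Finset.card_pos.2 (ensemble_nonempty hr hℓ hn)
  have hf := Nat.factorial_pos (r * m)
  have key : numEvenOn ℓ m r T * (r * m).choose (T.card * ℓ) ≤
      polyLoss ℓ m n * evenCount r m (T.card * ℓ) * (ensemble ℓ m r n).card := by
    have hD : 0 < ℓ.factorial ^ n * m.factorial ^ r := by positivity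
    refine Nat.le_of_mul_le_mul_right ?_ (Nat.mul_pos hD hf)
    calc _ = numEvenOn ℓ m r T * (ℓ.factorial ^ n * m.factorial ^ r) *
          (r * m).choose (T.card * ℓ) * (r * m).factorial := by ring
      _ ≤ (evenConfigs ℓ m r T).card * (r * m).choose (T.card * ℓ) * (r * m).factorial := by
          gcongr
      _ = evenCount r m (T.card * ℓ) * (r * m).factorial * (r * m).factorial := by rw [h3]
      _ ≤ evenCount r m (T.card * ℓ) * (polyLoss ℓ m n *
          ((ensemble ℓ m r n).card * (ℓ.factorial ^ n * m.factorial ^ r))) *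
            (r * m).factorial := by gcongr
      _ = _ := by ring
  have h4' : (0 : ℝ) < (r * m).choose (T.card * ℓ) := by exact_mod_cast h4
  have h5' : (0 : ℝ) < (ensemble ℓ m r n).card := by exact_mod_cast h5
  rw [mul_div_assoc', div_le_div_iff₀ h5' h4']
  exact_mod_cast key

/-- Here the switching bound is applied to the numerator, which forces both `T` and its complement
to have more than `2 * m` columns. -/
theorem evenCount_div_le (hr : n * ℓ = r * m) (hℓ : 0 < ℓ) (hn : 2 * m < n)
    (T : Finset (Fin n)) (hT : 2 * m < T.card) (hT' : 2 * m < n - T.card) :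
    (evenCount r m (T.card * ℓ) : ℝ) / (r * m).choose (T.card * ℓ) ≤
      polyLoss ℓ m n * ((numEvenOn ℓ m r T : ℝ) / (ensemble ℓ m r n).card) := by
  classical
  have h1 : (evenConfigs ℓ m r T).card ≤ polyLoss ℓ m n *
      (numEvenOn ℓ m r T * (ℓ.factorial ^ n * m.factorial ^ r)) :=
    card_evenOn_bounds (ℓ := ℓ) (m := m) (r := r) T
      (Nat.mul_pos (by omega) hℓ)
      (fun j _ => by
        rw [mul_comm ℓ m, ← mul_assoc]
        exact Nat.mul_lt_mul_of_pos_right hT hℓ)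
      (fun j _ => by
        rw [mul_comm ℓ m, ← mul_assoc]
        exact Nat.mul_lt_mul_of_pos_right hT' hℓ)
  have h2 := card_evenOn_le (ℓ := ℓ) (m := m) (r := r) (∅ : Finset (Fin n))
  rw [card_evenConfigs_empty hr, Finset.filter_true_of_mem fun H _ => evenOn_empty H] at h2
  have h3 := card_evenConfigs_mul_choose hr T
  have h4 := choose_pos_of_subset hr T
  have h5 := Finset.card_pos.2 (ensemble_nonempty hr hℓ hn)
  have hf := Nat.factorial_pos (r * m)
  have key : evenCount r m (T.card * ℓ) * (ensemble ℓ m r n).card ≤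
      polyLoss ℓ m n * numEvenOn ℓ m r T * (r * m).choose (T.card * ℓ) := by
    have hD : 0 < ℓ.factorial ^ n * m.factorial ^ r := by positivity
    refine Nat.le_of_mul_le_mul_right ?_ hD
    calc _ = evenCount r m (T.card * ℓ) *
          ((ensemble ℓ m r n).card * (ℓ.factorial ^ n * m.factorial ^ r)) := by ring
      _ ≤ evenCount r m (T.card * ℓ) * (r * m).factorial := by gcongr
      _ = (evenConfigs ℓ m r T).card * (r * m).choose (T.card * ℓ) := h3.symm
      _ ≤ polyLoss ℓ m n * (numEvenOn ℓ m r T * (ℓ.factorial ^ n * m.factorial ^ r)) *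
          (r * m).choose (T.card * ℓ) := by gcongr
      _ = _ := by ring
  have h4' : (0 : ℝ) < (r * m).choose (T.card * ℓ) := by exact_mod_cast h4
  have h5' : (0 : ℝ) < (ensemble ℓ m r n).card := by exact_mod_cast h5
  rw [mul_div_assoc', div_le_div_iff₀ h4' h5']
  exact_mod_cast key

/-- The binary vector on `J` with support `T`. -/
def indicatorOn (J T : Finset (Fin n)) : J → ZMod 2 := fun j => if (j : Fin n) ∈ T then 1 else 0

theorem mem_code_indicator_iff (H : Matrix (Fin r) (Fin n) (ZMod 2)) (T : Finset (Fin n)) :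
    (fun j => if j ∈ T then 1 else 0) ∈ code H ↔ EvenOn T H := by
  simp only [code, LinearMap.mem_ker, Matrix.mulVecLin_apply, funext_iff, EvenOn]
  refine forall_congr' fun i => ?_
  have h : (H.mulVec fun j => if j ∈ T then 1 else 0) i =
      ((T.filter fun j => H i j ≠ 0).card : ZMod 2) := by
    simp only [Matrix.mulVec, dotProduct, mul_ite, mul_one, mul_zero, Finset.sum_ite_mem,
      Finset.univ_inter, Finset.card_filter, Nat.cast_sum]
    refine Finset.sum_congr rfl fun j _ => ?_
    generalize H i j = z
    revert z
    decide
  rw [h, Pi.zero_apply, ZMod.natCast_eq_zero_iff_even]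

open Classical in
theorem numNonzero_eq (H : Matrix (Fin r) (Fin n) (ZMod 2)) (J : Finset (Fin n)) :
    numNonzero H J = ((J.powerset.erase ∅).filter fun T => EvenOn T H).card := by
  have hinj : Set.InjOn (indicatorOn J)
      ((J.powerset.erase ∅).filter fun T => EvenOn T H : Finset (Finset (Fin n))) := by
    intro T hT T' hT' h
    simp only [Finset.coe_filter, Finset.mem_erase, Finset.mem_powerset, Set.mem_ofPred_eq]
      at hT hT'
    ext j
    by_cases hj : j ∈ J
    · have := congrFun h ⟨j, hj⟩
      simp only [indicatorOn] at this
      by_cases h1 : j ∈ T <;> by_cases h2 : j ∈ T' <;> simp_all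
    · exact ⟨fun h => absurd (hT.1.2 h) hj, fun h => absurd (hT'.1.2 h) hj⟩
  rw [← Finset.card_image_of_injOn hinj, numNonzero, ← Set.ncard_coe_finset]
  congr 1
  ext x
  simp only [Set.mem_ofPred_eq, Finset.coe_image, Finset.coe_filter, Finset.mem_erase,
    Finset.mem_powerset, Set.mem_image, shortenedCode]
  constructor
  · rintro ⟨⟨c, hc, hcJ, rfl⟩, hne⟩
    set T := Finset.univ.filter fun j => c j ≠ 0 with hT
    have hcT : c = fun j => if j ∈ T then 1 else 0 := by
      funext j
      simp only [hT, Finset.mem_filter, Finset.mem_univ, true_and]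
      generalize c j = z
      revert z
      decide
    refine ⟨T, ⟨⟨?_, ?_⟩, ?_⟩, ?_⟩
    · rintro h0
      apply hne
      funext j
      rw [hcT, h0]
      simp
    · intro j hj
      by_contra hjJ
      exact (Finset.mem_filter.1 hj).2 (hcJ j hjJ)
    · rwa [← mem_code_indicator_iff, ← hcT]
    · funext j
      conv_rhs => rw [hcT]
      rfl
  · rintro ⟨T, ⟨⟨hne, hTJ⟩, hev⟩, rfl⟩
    refine ⟨⟨_, (mem_code_indicator_iff H T).2 hev, ?_, rfl⟩, ?_⟩
    · intro i hi
      exact if_neg fun h => hi (hTJ h)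
    · intro h0
      obtain ⟨j, hj⟩ := Finset.nonempty_iff_ne_empty.2 hne
      have := congrFun h0 ⟨j, hTJ hj⟩
      simp [indicatorOn, hj] at this

theorem avgNonzero_eq_sum (J : Finset (Fin n)) :
    avgNonzero ℓ m n J = ∑ T ∈ J.powerset.erase ∅,
      (numEvenOn ℓ m (ℓ * n / m) T : ℝ) / (ensemble ℓ m (ℓ * n / m) n).card := by
  classical
  rw [avgNonzero, ← Finset.sum_div]
  congr 1
  simp only [numNonzero_eq, numEvenOn, Finset.card_filter, Nat.cast_sum]
  rw [Finset.sum_comm]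

end Counting

/-! ### Entropy bounds for binomial coefficients -/

section Entropy

/-- In other words, `k ^ j / j!` is largest at `j = k`. -/
theorem factorial_mul_pow_le (j k : ℕ) : k.factorial * k ^ j ≤ j.factorial * k ^ k := by
  rcases le_total k j with h | h
  · calc k.factorial * k ^ j = k.factorial * k ^ (j - k) * k ^ k := by
          rw [mul_assoc, ← pow_add, Nat.sub_add_cancel h]
      _ ≤ _ := Nat.mul_le_mul_right _ (Nat.factorial_mul_pow_sub_le_factorial h)
  · have h1 := Nat.factorial_mul_descFactorial (Nat.sub_le k j)
    rw [Nat.sub_sub_self h] at h1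
    calc k.factorial * k ^ j = j.factorial * k.descFactorial (k - j) * k ^ j := by rw [h1]
      _ ≤ j.factorial * k ^ (k - j) * k ^ j := by
          gcongr; exact Nat.descFactorial_le_pow _ _
      _ = _ := by rw [mul_assoc, ← pow_add, Nat.sub_add_cancel h]

/-- In the binomial expansion of `(k + (N - k)) ^ N` the largest of the `N + 1` terms has index `k`.
-/
theorem pow_self_le_choose {N k : ℕ} (hk : k ≤ N) :
    N ^ N ≤ (N + 1) * (N.choose k * k ^ k * (N - k) ^ (N - k)) := by
  have h1 : N ^ N = ∑ j ∈ Finset.range (N + 1), k ^ j * (N - k) ^ (N - j) * N.choose j := by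
    have := add_pow k (N - k) N
    rw [Nat.add_sub_cancel' hk] at this
    simpa using this
  rw [h1]
  have h2 : ∀ j ∈ Finset.range (N + 1), k ^ j * (N - k) ^ (N - j) * N.choose j ≤
      N.choose k * k ^ k * (N - k) ^ (N - k) := by
    intro j hj
    have hj : j ≤ N := by simpa [Nat.lt_succ_iff] using hj
    have e1 := Nat.choose_mul_factorial_mul_factorial hj
    have e2 := Nat.choose_mul_factorial_mul_factorial hk
    have f1 := factorial_mul_pow_le j k
    have f2 := factorial_mul_pow_le (N - j) (N - k)
    have hpos : 0 < j.factorial * (N - j).factorial * (k.factorial * (N - k).factorial) := by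
      positivity
    refine Nat.le_of_mul_le_mul_right ?_ hpos
    calc _ = (N.choose j * j.factorial * (N - j).factorial) * ((k.factorial * k ^ j) *
            ((N - k).factorial * (N - k) ^ (N - j))) := by ring
      _ ≤ (N.choose j * j.factorial * (N - j).factorial) * ((j.factorial * k ^ k) *
            ((N - j).factorial * (N - k) ^ (N - k))) := by gcongr
      _ = (N.choose k * k.factorial * (N - k).factorial) * ((j.factorial * k ^ k) *
            ((N - j).factorial * (N - k) ^ (N - k))) := by rw [e1, e2]
      _ = _ := by ring
  refine (Finset.sum_le_card_nsmul _ _ _ h2).trans_eq ?_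
  simp

theorem exp_mul_binEntropy {a x : ℝ} (ha : 0 < a) (hx : 0 < x) (hxa : x < a) :
    Real.exp (a * Real.binEntropy (x / a)) = ((x / a) ^ x * (1 - x / a) ^ (a - x))⁻¹ := by
  have h1 : 0 < x / a := div_pos hx ha
  have h2 : 0 < 1 - x / a := sub_pos.2 ((div_lt_one ha).2 hxa)
  rw [Real.rpow_def_of_pos h1, Real.rpow_def_of_pos h2, ← Real.exp_add, ← Real.exp_neg,
    Real.binEntropy, Real.log_inv, Real.log_inv]
  congr 1
  field_simp
  ring

/-- One term of the expansion of `(x + (1 - x)) ^ J` at `x = w / a` is at most `1`. The real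
parameter `a ≥ J` permits `a = θ * n` with `J = ⌊θ * n⌋`, so the rounding costs nothing. -/
theorem choose_le_exp_binEntropy {J w : ℕ} {a : ℝ} (hJ : (J : ℝ) ≤ a) (hw : 0 < w)
    (hwJ : w ≤ J) : (J.choose w : ℝ) ≤ Real.exp (a * Real.binEntropy (w / a)) := by
  have hw' : (0 : ℝ) < w := by exact_mod_cast hw
  have hwJ' : (w : ℝ) ≤ J := by exact_mod_cast hwJ
  have ha : 0 < a := by linarith
  rcases (hwJ'.trans hJ).eq_or_lt with h | h
  · have : w = J := by
      have : (w : ℝ) = J := le_antisymm hwJ' (by linarith)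
      exact_mod_cast this
    rw [h, div_self ha.ne', this]
    simp
  · rw [exp_mul_binEntropy ha hw' h]
    have h1 : 0 < (w : ℝ) / a := div_pos hw' ha
    have h2 : 0 < 1 - (w : ℝ) / a := sub_pos.2 ((div_lt_one ha).2 h)
    have h3 : ((w : ℝ) / a) ^ w * (1 - w / a) ^ (J - w) * J.choose w ≤ 1 := by
      calc _ ≤ ∑ k ∈ Finset.range (J + 1), ((w : ℝ) / a) ^ k * (1 - w / a) ^ (J - k) *
            J.choose k := Finset.single_le_sum (f := fun k => ((w : ℝ) / a) ^ k *
              (1 - w / a) ^ (J - k) * J.choose k) (fun k _ => by positivity)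
              (by simpa [Nat.lt_succ_iff] using hwJ)
        _ = 1 := by rw [← add_pow]; simp
    have h4 : (1 - (w : ℝ) / a) ^ (a - w) ≤ (1 - (w : ℝ) / a) ^ (J - w) := by
      rw [← Real.rpow_natCast, Nat.cast_sub hwJ]
      exact Real.rpow_le_rpow_of_exponent_ge h2 (by linarith [h1]) (by linarith)
    rw [Real.rpow_natCast, ← one_div, le_div_iff₀ (by positivity)]
    refine le_trans ?_ h3
    rw [mul_comm]
    gcongr

theorem exp_binEntropy_le_choose {N k : ℕ} (hk : k ≤ N) :
    Real.exp (N * Real.binEntropy (k / N)) ≤ (N + 1) * N.choose k := by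
  rcases Nat.eq_zero_or_pos k with rfl | hk0
  · simp
  rcases hk.eq_or_lt with rfl | hkN
  · have : (k : ℝ) ≠ 0 := by positivity
    simp [this]
  have h0 : (0 : ℝ) < k := by exact_mod_cast hk0
  have h1 : (k : ℝ) < N := by exact_mod_cast hkN
  have hN : (0 : ℝ) < N := by linarith
  have h2 : (N : ℝ) ^ N ≤ (N + 1) * (N.choose k * k ^ k * (N - k) ^ (N - k)) := by
    have := pow_self_le_choose hk
    have h : ((N - k : ℕ) : ℝ) = N - k := by push_cast [hk]; ring
    rw [← h]
    exact_mod_cast this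
  have h3 : (0 : ℝ) < N - k := by linarith
  rw [exp_mul_binEntropy hN h0 h1, ← Nat.cast_sub hk, Real.rpow_natCast, Real.rpow_natCast,
    one_sub_div hN.ne', div_pow, div_pow, inv_le_iff_one_le_mul₀ (by positivity), div_mul_div_comm,
    ← pow_add, Nat.add_sub_cancel' hk, mul_div_assoc', one_le_div (by positivity)]
  refine h2.trans_eq ?_
  ring

end Entropy

/-! ### Coefficients of powers of the even generating function -/

section EvenCount

/-- The even subsets of a set of size `m`. -/
def evens (m : ℕ) : Finset (Finset (Fin m)) := Finset.univ.filter fun U => Even U.card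

/-- The generating function of the even subsets, in the exponential parametrisation. -/
noncomputable def evenZ (m : ℕ) (u : ℝ) : ℝ := partitionFn (evens m) (fun U => (U.card : ℝ)) u

/-- The mean size of an even subset under the weights `exp (u * card)`. -/
noncomputable def evenMean (m : ℕ) (u : ℝ) : ℝ := gibbsMean (evens m) (fun U => (U.card : ℝ)) u

theorem empty_mem_evens (m : ℕ) : ∅ ∈ evens m := by simp [evens]

theorem evens_nonempty (m : ℕ) : (evens m).Nonempty := ⟨∅, empty_mem_evens m⟩

theorem evenZ_pos (m : ℕ) (u : ℝ) : 0 < evenZ m u := partitionFn_pos (evens_nonempty m) u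

theorem card_le_of_mem_evens {m : ℕ} {U : Finset (Fin m)} (hU : U ∈ evens m) :
    U.card ≤ 2 * (m / 2) := by
  have h1 : Even U.card := by simpa [evens] using hU
  have h2 : U.card ≤ m := by simpa using Finset.card_le_univ U
  obtain ⟨k, hk⟩ := h1
  omega

theorem exists_mem_evens_card (m : ℕ) : ∃ U ∈ evens m, U.card = 2 * (m / 2) := by
  obtain ⟨U, _, hU⟩ := Finset.exists_subset_card_eq (s := (Finset.univ : Finset (Fin m)))
    (n := 2 * (m / 2)) (by simp; omega)
  exact ⟨U, by simp [evens, hU], hU⟩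

variable {r m : ℕ}

theorem sum_evenCount_mul_exp (r m : ℕ) (u : ℝ) :
    ∑ v ∈ Finset.range (r * m + 1), evenCount r m v * Real.exp (u * v) = evenZ m u ^ r := by
  have h1 : evenZ m u ^ r = ∑ f ∈ Fintype.piFinset fun _ : Fin r => evens m,
      Real.exp (u * (∑ i, (f i).card : ℕ)) := by
    rw [evenZ, partitionFn, ← Fin.prod_const, Finset.prod_univ_sum]
    refine Finset.sum_congr rfl fun f _ => ?_
    rw [← Real.exp_sum]
    congr 1
    push_cast
    rw [Finset.mul_sum]
    exact Finset.sum_congr rfl fun i _ => mul_comm _ _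
  rw [h1, ← Finset.sum_fiberwise_of_maps_to (t := Finset.range (r * m + 1))
    (g := fun f : Fin r → Finset (Fin m) => ∑ i, (f i).card)]
  · refine Finset.sum_congr rfl fun v _ => ?_
    rw [Finset.sum_congr rfl (g := fun _ => Real.exp (u * v)), Finset.sum_const, nsmul_eq_mul,
      evenCount]
    · congr 3
      ext f
      simp [evens]
    · intro f hf
      rw [(Finset.mem_filter.1 hf).2]
  · intro f _
    rw [Finset.mem_range, Nat.lt_succ_iff]
    calc ∑ i, (f i).card ≤ ∑ i : Fin r, m :=
          Finset.sum_le_sum fun i _ => by simpa using Finset.card_le_univ (f i)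
      _ = r * m := by simp

theorem evenCount_eq_zero {v : ℕ} (hv : r * (2 * (m / 2)) < v) : evenCount r m v = 0 := by
  rw [evenCount, Finset.card_eq_zero, Finset.filter_eq_empty_iff]
  rintro f _ ⟨h1, h2⟩
  have : ∑ i, (f i).card ≤ ∑ i : Fin r, 2 * (m / 2) :=
    Finset.sum_le_sum fun i _ => card_le_of_mem_evens (by simp [evens, h1 i])
  simp at this
  omega

theorem evenCount_mul_exp_le (r m v : ℕ) (u : ℝ) :
    evenCount r m v * Real.exp (u * v) ≤ evenZ m u ^ r := by
  rw [← sum_evenCount_mul_exp]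
  by_cases hv : v ∈ Finset.range (r * m + 1)
  · exact Finset.single_le_sum (f := fun v : ℕ => (evenCount r m v : ℝ) * Real.exp (u * v))
      (fun _ _ => by positivity) hv
  · rw [evenCount_eq_zero, Nat.cast_zero, zero_mul]
    · exact Finset.sum_nonneg fun _ _ => by positivity
    · rw [Finset.mem_range, not_lt] at hv
      have : r * (2 * (m / 2)) ≤ r * m := Nat.mul_le_mul_left _ (by omega)
      omega

theorem even_of_evenCount_ne_zero {v : ℕ} (hv : evenCount r m v ≠ 0) : Even v := by
  rw [evenCount, Finset.card_ne_zero] at hv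
  obtain ⟨f, hf⟩ := hv
  obtain ⟨h1, h2⟩ := (Finset.mem_filter.1 hf).2
  rw [← h2]
  exact Finset.even_sum _ fun i _ => h1 i

/-- Some component can be enlarged by two elements. The original family is recovered from the new
one by restoring that component, for which there are at most `r * 2 ^ m` possibilities. -/
theorem evenCount_le_add_two {v : ℕ} (hv : v < r * (2 * (m / 2))) :
    evenCount r m v ≤ r * 2 ^ m * evenCount r m (v + 2) := by
  have hsub : (Finset.univ.filter fun f : Fin r → Finset (Fin m) =>
        (∀ i, Even (f i).card) ∧ ∑ i, (f i).card = v) ⊆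
      ((Finset.univ : Finset (Fin r × Finset (Fin m))) ×ˢ
        (Finset.univ.filter fun f : Fin r → Finset (Fin m) =>
          (∀ i, Even (f i).card) ∧ ∑ i, (f i).card = v + 2)).image
        fun x => Function.update x.2 x.1.1 x.1.2 := by
    intro f hf
    obtain ⟨h1, h2⟩ := (Finset.mem_filter.1 hf).2
    obtain ⟨i, hi⟩ : ∃ i, (f i).card < 2 * (m / 2) := by
      by_contra! h
      have : ∑ i : Fin r, 2 * (m / 2) ≤ ∑ i, (f i).card := Finset.sum_le_sum fun i _ => h i
      simp at this
      omega
    obtain ⟨k, hk⟩ := h1 i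
    obtain ⟨U, hU, hUc⟩ := Finset.exists_superset_card_eq (s := f i) (n := (f i).card + 2)
      (by omega) (by simp; omega)
    refine Finset.mem_image.2 ⟨((i, f i), Function.update f i U), ?_, by simp⟩
    simp only [Finset.mem_product, Finset.mem_univ, true_and, Finset.mem_filter]
    constructor
    · intro j
      rcases eq_or_ne j i with rfl | hj
      · rw [Function.update_self, hUc]
        exact (h1 j).add even_two
      · rw [Function.update_of_ne hj]
        exact h1 j
    · rw [← h2, ← Finset.add_sum_erase _ _ (Finset.mem_univ i),
        ← Finset.add_sum_erase _ (fun i => (f i).card) (Finset.mem_univ i), Function.update_self,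
        hUc, Finset.sum_congr rfl (g := fun j => (f j).card)]
      · ring
      · intro j hj
        rw [Function.update_of_ne (Finset.ne_of_mem_erase hj)]
  calc evenCount r m v ≤ _ := Finset.card_le_card hsub
    _ ≤ _ := Finset.card_image_le
    _ = _ := by
      rw [Finset.card_product]
      simp [evenCount]

theorem evenCount_le_add_two_mul {v : ℕ} (j : ℕ) (hv : v + 2 * j ≤ r * (2 * (m / 2))) :
    evenCount r m v ≤ (r * 2 ^ m) ^ j * evenCount r m (v + 2 * j) := by
  induction j with
  | zero => simp
  | succ j ih =>
    calc evenCount r m v ≤ (r * 2 ^ m) ^ j * evenCount r m (v + 2 * j) := ih (by omega)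
      _ ≤ (r * 2 ^ m) ^ j * (r * 2 ^ m * evenCount r m (v + 2 * j + 2)) :=
          Nat.mul_le_mul_left _ (evenCount_le_add_two (by omega))
      _ = _ := by rw [show v + 2 * (j + 1) = v + 2 * j + 2 by ring]; ring

/-- Large deviations: weights away from the mean are exponentially unlikely. -/
theorem exists_evenCount_tail (m : ℕ) (u : ℝ) {ε : ℝ} (hε : 0 < ε) :
    ∃ δ > 0, ∀ r v : ℕ, ε * r < |(v : ℝ) - evenMean m u * r| →
      evenCount r m v * Real.exp (u * v) ≤ evenZ m u ^ r * Real.exp (-(δ * r)) := by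
  have hd : HasDerivAt (fun u => Real.log (evenZ m u)) (evenMean m u) u :=
    hasDerivAt_log_partitionFn (evens_nonempty m) u
  have hsl := hasDerivAt_iff_tendsto_slope.1 hd
  have hev := hsl.eventually (Ioo_mem_nhds (a := evenMean m u - ε / 2) (b := evenMean m u + ε / 2)
    (by linarith) (by linarith))
  -- Chernoff's bound at a second parameter `s`, rewritten relative to the weights at `u`.
  have hgen : ∀ s : ℝ, ∀ r v : ℕ, evenCount r m v * Real.exp (u * v) ≤
      evenZ m u ^ r *
        Real.exp (r * (Real.log (evenZ m s) - Real.log (evenZ m u)) - (s - u) * v) := by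
    intro s r v
    have h := evenCount_mul_exp_le r m v s
    have h1 : evenZ m s ^ r = Real.exp (r * Real.log (evenZ m s)) := by
      rw [mul_comm, Real.exp_mul, Real.exp_log (evenZ_pos m s), Real.rpow_natCast]
    have h2 : evenZ m u ^ r = Real.exp (r * Real.log (evenZ m u)) := by
      rw [mul_comm, Real.exp_mul, Real.exp_log (evenZ_pos m u), Real.rpow_natCast]
    rw [h2, ← Real.exp_add]
    rw [h1] at h
    calc _ = evenCount r m v * Real.exp (s * v) * Real.exp ((u - s) * v) := by
          rw [mul_assoc, ← Real.exp_add]; congr 2; ring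
      _ ≤ Real.exp (r * Real.log (evenZ m s)) * Real.exp ((u - s) * v) := by gcongr
      _ = _ := by rw [← Real.exp_add]; congr 1; ring
  -- Choose `s < u < t` so close to `u` that the difference quotients of `log evenZ` are within `ε /
  -- 2` of the mean on the side needed. A deviation beyond `ε * r` then leaves a gain of at least
  -- `(ε / 2) * r` times the distance to `u`.
  obtain ⟨s, ⟨hs1, -⟩, hsu⟩ := ((hev.filter_mono
    (nhdsWithin_mono u fun x (hx : x ∈ Set.Iio u) => (ne_of_lt hx : x ≠ u))).and
      self_mem_nhdsWithin).exists
  obtain ⟨t, ⟨-, ht2⟩, htu⟩ := ((hev.filter_mono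
    (nhdsWithin_mono u fun x (hx : x ∈ Set.Ioi u) => (ne_of_gt hx : x ≠ u))).and
      self_mem_nhdsWithin).exists
  have hsu' : s < u := hsu
  have htu' : u < t := htu
  rw [slope_def_field, lt_div_iff_of_neg (by linarith)] at hs1
  rw [slope_def_field, div_lt_iff₀ (by linarith)] at ht2
  refine ⟨min (u - s) (t - u) * (ε / 2), by
    have : 0 < min (u - s) (t - u) := lt_min (by linarith) (by linarith)
    positivity, fun r v hv => ?_⟩
  have hr : (0 : ℝ) ≤ r := Nat.cast_nonneg r
  have hmin1 := mul_le_mul_of_nonneg_right (min_le_left (u - s) (t - u))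
    (by positivity : 0 ≤ ε / 2 * r)
  have hmin2 := mul_le_mul_of_nonneg_right (min_le_right (u - s) (t - u))
    (by positivity : 0 ≤ ε / 2 * r)
  rcases lt_abs.1 hv with h | h
  · refine (hgen t r v).trans ?_
    have := evenZ_pos m u
    gcongr
    have a1 := mul_le_mul_of_nonneg_left ht2.le hr
    have a2 := mul_le_mul_of_nonneg_left h.le (sub_nonneg.2 htu'.le)
    nlinarith
  · refine (hgen s r v).trans ?_
    have := evenZ_pos m u
    gcongr
    have a1 := mul_le_mul_of_nonneg_left hs1.le hr
    have a2 := mul_le_mul_of_nonneg_left h.le (sub_nonneg.2 hsu'.le)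
    nlinarith

/-- The largest of the `r * m + 1` terms of `evenZ m u ^ r` carries its share of the sum; by the
tail bound, a term far from the mean is too small for that. -/
theorem exists_evenCount_large (m : ℕ) (u : ℝ) {ε : ℝ} (hε : 0 < ε) :
    ∀ᶠ r : ℕ in atTop, ∃ v : ℕ, |(v : ℝ) - evenMean m u * r| ≤ ε * r ∧
      evenZ m u ^ r ≤ (r * m + 1) * (evenCount r m v * Real.exp (u * v)) := by
  obtain ⟨δ, hδ, htail⟩ := exists_evenCount_tail m u hε
  have hlim : Tendsto (fun r : ℕ => ((r : ℝ) * m + 1) * Real.exp (-(δ * r))) atTop (𝓝 0) := by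
    have h0 : Tendsto (fun r : ℕ => δ * (r : ℝ)) atTop atTop :=
      tendsto_natCast_atTop_atTop.const_mul_atTop hδ
    have h1 := ((Real.tendsto_pow_mul_exp_neg_atTop_nhds_zero 1).comp h0).const_mul ((m : ℝ) / δ)
    have h2 := (Real.tendsto_pow_mul_exp_neg_atTop_nhds_zero 0).comp h0
    convert h1.add h2 using 1
    · funext r
      simp only [Function.comp_apply, pow_one, pow_zero]
      field_simp
    · simp
  filter_upwards [hlim.eventually_lt_const one_pos] with r hr
  have hne : (Finset.range (r * m + 1)).Nonempty := ⟨0, by simp⟩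
  obtain ⟨v, _, hmax⟩ := Finset.exists_max_image (Finset.range (r * m + 1))
    (fun v : ℕ => (evenCount r m v : ℝ) * Real.exp (u * v)) hne
  have hZ := evenZ_pos m u
  have hbig : evenZ m u ^ r ≤ (r * m + 1) * (evenCount r m v * Real.exp (u * v)) := by
    rw [← sum_evenCount_mul_exp]
    refine (Finset.sum_le_card_nsmul _ _ _ hmax).trans_eq ?_
    simp
  refine ⟨v, ?_, hbig⟩
  by_contra! h
  have h1 := htail r v h
  have h2 : evenZ m u ^ r ≤ evenZ m u ^ r * ((r * m + 1) * Real.exp (-(δ * r))) := by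
    calc _ ≤ _ := hbig
      _ ≤ (r * m + 1) * (evenZ m u ^ r * Real.exp (-(δ * r))) := by gcongr
      _ = _ := by ring
  have h3 := pow_pos hZ r
  nlinarith

theorem evenMean_lt {m : ℕ} (hm : 2 ≤ m) (u : ℝ) : evenMean m u < (2 * (m / 2) : ℕ) := by
  refine gibbsMean_lt (evens_nonempty m) (fun U hU => ?_) ⟨∅, empty_mem_evens m, ?_⟩ u
  · exact_mod_cast card_le_of_mem_evens hU
  · simp only [Finset.card_empty]
    exact_mod_cast (by omega : 0 < 2 * (m / 2))

/-- Close to the mean there is a multiple `w ℓ` of `ℓ` at which the coefficient of the generating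
function is as large as possible, up to a polynomial factor. -/
theorem exists_evenCount_mul_large {ℓ m : ℕ} (hℓ : 0 < ℓ) (hm : 2 ≤ m) (u : ℝ) {ε : ℝ}
    (hε : 0 < ε) :
    ∀ᶠ r : ℕ in atTop, ∃ w : ℕ, |((w * ℓ : ℕ) : ℝ) - evenMean m u * r| ≤ ε * r ∧
      evenZ m u ^ r ≤ (r * m + 1) * (r * 2 ^ m) ^ ℓ * Real.exp (2 * ℓ * |u|) *
        (evenCount r m (w * ℓ) * Real.exp (u * (w * ℓ : ℕ))) := by
  set M : ℝ := ((2 * (m / 2) : ℕ) : ℝ) with hM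
  have hμ := evenMean_lt hm u
  rw [← hM] at hμ
  -- Half of `ε`, and half of the gap between the mean and the largest even size `M`, are reserved
  -- so that an increase of `v` by up to `2 * ℓ` stays close to the mean and below `r * M`.
  set ε' := min (ε / 2) ((M - evenMean m u) / 2) with hε'
  have hε'0 : 0 < ε' := lt_min (by linarith) (by linarith)
  have hlarge : ∀ᶠ r : ℕ in atTop, (2 * ℓ : ℝ) / ε' ≤ r :=
    tendsto_natCast_atTop_atTop.eventually_ge_atTop _
  filter_upwards [exists_evenCount_large m u hε'0, hlarge, eventually_ge_atTop 1] with r hr hrl hr1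
  obtain ⟨v, hv, hbig⟩ := hr
  rw [div_le_iff₀ hε'0] at hrl
  have hr0 : (0 : ℝ) < r := by exact_mod_cast hr1
  have hne : evenCount r m v ≠ 0 := by
    intro h
    rw [h] at hbig
    have := pow_pos (evenZ_pos m u) r
    simp at hbig
    linarith
  obtain ⟨k, hk⟩ := even_of_evenCount_ne_zero hne
  -- Since `v = k + k` is even, at most `ℓ` increments by two make it a multiple of `2 * ℓ`.
  obtain ⟨j, hjℓ, w', hw'⟩ : ∃ j ≤ ℓ, ∃ w', k + j = ℓ * w' := by
    refine ⟨ℓ - k % ℓ, Nat.sub_le _ _, k / ℓ + 1, ?_⟩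
    have h1 := Nat.div_add_mod k ℓ
    have h2 := Nat.mod_lt k hℓ
    rw [mul_add, mul_one]
    omega
  have hw : 2 * w' * ℓ = v + 2 * j := by rw [hk, mul_assoc, mul_comm w' ℓ, ← hw']; ring
  have hjℓ' : (j : ℝ) ≤ ℓ := by exact_mod_cast hjℓ
  rw [abs_le] at hv
  have e1 : ε' * r ≤ ε / 2 * r := mul_le_mul_of_nonneg_right (min_le_left _ _) hr0.le
  have e2 : ε' * r ≤ (M - evenMean m u) / 2 * r :=
    mul_le_mul_of_nonneg_right (min_le_right _ _) hr0.le
  have hj0 : (0 : ℝ) ≤ j := Nat.cast_nonneg j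
  refine ⟨2 * w', ?_, ?_⟩
  · rw [hw]
    push_cast
    rw [abs_le]
    constructor <;> linarith
  · rw [hw]
    have hle : v + 2 * j ≤ r * (2 * (m / 2)) := by
      have : ((v + 2 * j : ℕ) : ℝ) ≤ (r * (2 * (m / 2)) : ℕ) := by
        rw [Nat.cast_mul r, ← hM]
        push_cast
        nlinarith
      exact_mod_cast this
    have h1 : (evenCount r m v : ℝ) ≤ (r * 2 ^ m) ^ ℓ * evenCount r m (v + 2 * j) := by
      have h2 := evenCount_le_add_two_mul j hle
      have h3 : (r * 2 ^ m) ^ j ≤ (r * 2 ^ m) ^ ℓ :=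
        Nat.pow_le_pow_right (Nat.mul_pos hr1 (by positivity)) hjℓ
      exact_mod_cast h2.trans (Nat.mul_le_mul_right _ h3)
    have h2 : Real.exp (u * v) ≤
        Real.exp (2 * ℓ * |u|) * Real.exp (u * (v + 2 * j : ℕ)) := by
      rw [← Real.exp_add]
      gcongr
      push_cast
      have a1 := mul_le_mul_of_nonneg_right hjℓ' (abs_nonneg u)
      have a2 := mul_le_mul_of_nonneg_left (neg_abs_le u) hj0
      nlinarith
    calc _ ≤ _ := hbig
      _ ≤ (r * m + 1) * (((r * 2 ^ m) ^ ℓ * evenCount r m (v + 2 * j)) *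
          (Real.exp (2 * ℓ * |u|) * Real.exp (u * (v + 2 * j : ℕ)))) := by gcongr
      _ = _ := by ring

end EvenCount

/-! ### The exponent `q` as a dual function, and the maximal growth rate -/

section Objective

theorem evenZ_eq (m : ℕ) (u : ℝ) :
    evenZ m u = ((1 + Real.exp u) ^ m + (1 - Real.exp u) ^ m) / 2 := by
  have h1 := Fintype.sum_pow_mul_eq_add_pow (Fin m) (Real.exp u) 1
  have h2 := Fintype.sum_pow_mul_eq_add_pow (Fin m) (-Real.exp u) 1
  simp only [one_pow, mul_one, Fintype.card_fin] at h1 h2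
  rw [add_comm (1 : ℝ), sub_eq_neg_add, ← h1, ← h2, ← Finset.sum_add_distrib, Finset.sum_div,
    evenZ, partitionFn, evens, Finset.sum_filter]
  refine Finset.sum_congr rfl fun U _ => ?_
  split_ifs with h
  · rw [h.neg_pow, ← Real.exp_nat_mul]
    ring
  · rw [(Nat.not_even_iff_odd.1 h).neg_pow]
    ring

/-- Differentiating `evenZ` as a sum over even subsets and in closed form expresses the mean size
through powers of `1 ± t`; with `t = exp u`, the root equation says that this mean is `m * β`. -/
theorem isPosRoot_exp_iff {m : ℕ} (hm : 0 < m) (β u : ℝ) :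
    IsPosRoot m β (Real.exp u) ↔ evenMean m u = m * β := by
  have hZ := evenZ_pos m u
  have hd1 : HasDerivAt (evenZ m) (∑ U ∈ evens m, (U.card : ℝ) * Real.exp (U.card * u)) u :=
    hasDerivAt_partitionFn u
  have hd2 : HasDerivAt (evenZ m) ((m * (1 + Real.exp u) ^ (m - 1) * Real.exp u +
      m * (1 - Real.exp u) ^ (m - 1) * (-Real.exp u)) / 2) u := by
    have h := ((((Real.hasDerivAt_exp u).const_add 1).fun_pow m).fun_add
      (((Real.hasDerivAt_exp u).const_sub 1).fun_pow m)).div_const 2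
    rwa [← show evenZ m = fun u => ((1 + Real.exp u) ^ m + (1 - Real.exp u) ^ m) / 2 from
      funext (evenZ_eq m)] at h
  have hmean : evenMean m u = ((m * (1 + Real.exp u) ^ (m - 1) * Real.exp u +
      m * (1 - Real.exp u) ^ (m - 1) * (-Real.exp u)) / 2) / evenZ m u := by
    rw [← hd1.unique hd2]; rfl
  rw [hmean, div_eq_iff hZ.ne', IsPosRoot, and_iff_right (Real.exp_pos u)]
  have hD : (1 + Real.exp u) ^ m + (1 - Real.exp u) ^ m = 2 * evenZ m u := by
    rw [evenZ_eq]; ring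
  have hD' : 2 * evenZ m u = (1 + Real.exp u) ^ (m - 1) * (1 + Real.exp u) +
      (1 - Real.exp u) ^ (m - 1) * (1 - Real.exp u) := by
    rw [← hD, ← pow_succ, ← pow_succ, Nat.sub_add_cancel hm]
  rw [hD, div_eq_iff (by positivity)]
  have hm' : (0 : ℝ) < m := by exact_mod_cast hm
  generalize (1 + Real.exp u) ^ (m - 1) = a at *
  generalize (1 - Real.exp u) ^ (m - 1) = b at *
  constructor
  · intro h
    linear_combination (-(m : ℝ) / 2) * h - (m / 2 : ℝ) * hD'
  · intro h
    have : (m : ℝ) * (a + b) = m * ((1 - β) * (2 * evenZ m u)) := by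
      linear_combination (-2) * h - (m : ℝ) * hD'
    exact mul_left_cancel₀ hm'.ne' this

/-- The exponent of the even coefficients. -/
noncomputable def evenDual (m : ℕ) (y : ℝ) : ℝ := dualFn (evens m) (fun U => (U.card : ℝ)) y

theorem evenDual_evenMean (m : ℕ) (u : ℝ) :
    evenDual m (evenMean m u) = Real.log (evenZ m u) - evenMean m u * u :=
  dualFn_gibbsMean (evens_nonempty m) u

theorem exists_evenMean_eq {m : ℕ} {y : ℝ} (hy0 : 0 < y) (hy1 : y < (2 * (m / 2) : ℕ)) :
    ∃ u, evenMean m u = y := by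
  obtain ⟨V, hV, hVc⟩ := exists_mem_evens_card m
  rw [← hVc] at hy1
  exact exists_gibbsMean_eq (empty_mem_evens m) hV ⟨by simpa using hy0, hy1⟩

theorem continuousOn_evenDual (m : ℕ) :
    ContinuousOn (evenDual m) (Set.Icc 0 (2 * (m / 2) : ℕ)) := by
  obtain ⟨V, hV, hVc⟩ := exists_mem_evens_card m
  have := continuousOn_dualFn (κ := fun U : Finset (Fin m) => (U.card : ℝ)) (empty_mem_evens m) hV
  simp only [hVc, Finset.card_empty, Nat.cast_zero] at this
  exact this

/-- If a single index has the extremal energy, its term dominates the normalised sum; this yields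
the value `0` of `evenDual` at the sizes `0` and, for even `m`, `m`. -/
theorem tendsto_sum_exp_of_unique {ι : Type*} [DecidableEq ι] {s : Finset ι} {κ : ι → ℝ} {i : ι}
    (hi : i ∈ s) {F : Filter ℝ}
    (h : ∀ k ∈ s, k ≠ i → Tendsto (fun u => (κ k - κ i) * u) F atBot) :
    Tendsto (fun u => ∑ k ∈ s, Real.exp ((κ k - κ i) * u)) F (𝓝 1) := by
  have h1 : (1 : ℝ) = ∑ k ∈ s, if k = i then 1 else 0 := by simp [hi]
  rw [h1]
  refine tendsto_finsetSum _ fun k hk => ?_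
  split_ifs with hki
  · subst hki
    simp only [sub_self, zero_mul, Real.exp_zero]
    exact tendsto_const_nhds
  · exact Real.tendsto_exp_atBot.comp (h k hk hki)

theorem evenDual_zero (m : ℕ) : evenDual m 0 = 0 := by
  have h := tendsto_sum_exp_of_unique (κ := fun U : Finset (Fin m) => (U.card : ℝ))
    (empty_mem_evens m) (F := atBot) fun k _ hk => by
      have : 0 < k.card := Finset.card_pos.2 (Finset.nonempty_iff_ne_empty.2 hk)
      simpa using tendsto_id.const_mul_atBot (r := (k.card : ℝ)) (by exact_mod_cast this)
  have := dualFn_eq_zero_of_tendsto (empty_mem_evens m) (empty_mem_evens m) ⟨le_rfl, le_rfl⟩ h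
  simpa [evenDual] using this

theorem evenDual_self {m : ℕ} (hm : Even m) : evenDual m m = 0 := by
  have hu : (Finset.univ : Finset (Fin m)) ∈ evens m := by simp [evens, hm]
  have h := tendsto_sum_exp_of_unique (κ := fun U : Finset (Fin m) => (U.card : ℝ))
    hu (F := atTop) fun k _ hk => by
      have h1 : k.card < m := by
        simpa using Finset.card_lt_card (Finset.ssubset_univ_iff.2 hk)
      have h2 : (k.card : ℝ) < m := by exact_mod_cast h1
      refine (tendsto_const_mul_atBot_of_neg ?_).2 tendsto_id
      simpa using h2
  have := dualFn_eq_zero_of_tendsto hu hu ⟨le_rfl, le_rfl⟩ h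
  simpa [evenDual] using this

theorem two_mul_half_of_even {m : ℕ} (hm : Even m) : 2 * (m / 2) = m :=
  Nat.two_mul_div_two_of_even hm

theorem cast_two_mul_half_of_odd {m : ℕ} (hm : Odd m) : ((2 * (m / 2) : ℕ) : ℝ) = m - 1 := by
  have h := Nat.two_mul_div_two_add_one_of_odd hm
  have : ((2 * (m / 2) + 1 : ℕ) : ℝ) = m := by rw [h]
  push_cast at this ⊢
  linarith

/-- In the range where the exponent is finite, it is given by the dual function. -/
theorem q_eq {m : ℕ} (hm : 3 ≤ m) (α : ℝ) {x : ℝ} (hx0 : 0 < x) (hx1 : x ≤ 1)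
    (hx : ¬ (Odd m ∧ 1 - 1 / (m : ℝ) ≤ x)) :
    q m α x = (((α * evenDual m (m * x) - α * m * Real.binEntropy x) / Real.log 2 : ℝ) : EReal) := by
  have hm0 : (0 : ℝ) < m := by exact_mod_cast (by omega : 0 < m)
  rw [q, if_neg hx]
  rcases hx1.eq_or_lt with rfl | hx1
  · have hev : Even m := by
      rw [← Nat.not_odd_iff_even]
      intro ho
      refine hx ⟨ho, ?_⟩
      have : 0 < 1 / (m : ℝ) := by positivity
      linarith
    rw [if_pos (Or.inr rfl), mul_one, evenDual_self hev]
    simp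
  · rw [if_neg (by rintro (h | h) <;> linarith)]
    have hlt : (m : ℝ) * x < (2 * (m / 2) : ℕ) := by
      rcases Nat.even_or_odd m with he | ho
      · rw [two_mul_half_of_even he]
        nlinarith
      · rw [cast_two_mul_half_of_odd ho]
        have : x < 1 - 1 / m := by
          by_contra! h
          exact hx ⟨ho, h⟩
        have h1 := mul_lt_mul_of_pos_left this hm0
        rw [mul_sub, mul_one, mul_one_div_cancel hm0.ne'] at h1
        exact h1
    obtain ⟨u, hu⟩ := exists_evenMean_eq (mul_pos hm0 hx0) hlt
    -- Existence of a root suffices: every `u` with the prescribed mean gives the same dual value,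
    -- so uniqueness plays no role.
    have hroot : IsPosRoot m x (root m x) :=
      Classical.epsilon_spec (p := IsPosRoot m x)
        ⟨_, (isPosRoot_exp_iff (by omega) x u).2 hu⟩
    have ht := hroot.1
    set t := root m x
    rw [← Real.exp_log ht, isPosRoot_exp_iff (by omega)] at hroot
    have hdual := evenDual_evenMean m (Real.log t)
    rw [hroot] at hdual
    have hZ := evenZ_pos m (Real.log t)
    have hZ' := evenZ_eq m (Real.log t)
    rw [Real.exp_log ht] at hZ'
    congr 1
    have h1 : ((1 + t) ^ m + (1 - t) ^ m) / (2 * t ^ (x * (m : ℝ))) =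
        evenZ m (Real.log t) / t ^ (x * (m : ℝ)) := by
      rw [hZ', div_div]
    rw [h1, Real.logb, Real.log_div hZ.ne' (Real.rpow_pos_of_pos ht _).ne', Real.log_rpow ht,
      hdual, h]
    ring

/-- The exponent of the mean number of codewords of relative weight `x`, in nats. -/
noncomputable def growth (ℓ m : ℕ) (θ x : ℝ) : ℝ :=
  (ℓ : ℝ) / m * evenDual m (m * x) - ℓ * Real.binEntropy x + θ * Real.binEntropy (x / θ)

variable {ℓ m : ℕ} {θ : ℝ}

theorem objective_eq (hm : 3 ≤ m) (hθ0 : 0 < θ) (hθ1 : θ ≤ 1) {β : ℝ} (hβ : β ∈ Set.Ioc (0 : ℝ) 1)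
    (hx : ¬ (Odd m ∧ 1 - 1 / (m : ℝ) ≤ β * θ)) :
    objective ℓ m θ β = ((growth ℓ m θ (β * θ) / Real.log 2 : ℝ) : EReal) := by
  have hm0 : (m : ℝ) ≠ 0 := by exact_mod_cast (by omega : m ≠ 0)
  rw [objective, q_eq hm _ (mul_pos hβ.1 hθ0) (by nlinarith [hβ.1, hβ.2]) hx, ← EReal.coe_add]
  congr 1
  rw [growth, h, mul_div_cancel_right₀ _ hθ0.ne', div_mul_cancel₀ _ hm0]
  ring

theorem objective_eq_bot {β : ℝ} (hx : Odd m ∧ 1 - 1 / (m : ℝ) ≤ β * θ) :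
    objective ℓ m θ β = ⊥ := by
  rw [objective, q, if_pos hx, EReal.bot_add]

/-- The largest relative weight with a finite exponent. -/
noncomputable def maxWeight (m : ℕ) (θ : ℝ) : ℝ := min ((2 * (m / 2) : ℕ) / m) θ

theorem maxWeight_pos (hm : 3 ≤ m) (hθ0 : 0 < θ) : 0 < maxWeight m θ := by
  refine lt_min (div_pos ?_ ?_) hθ0
  · exact_mod_cast (by omega : 0 < 2 * (m / 2))
  · exact_mod_cast (by omega : 0 < m)

theorem mul_mem_of_mem (hm : 3 ≤ m) {x : ℝ} (hx : x ∈ Set.Icc 0 (maxWeight m θ)) :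
    (m : ℝ) * x ∈ Set.Icc (0 : ℝ) (2 * (m / 2) : ℕ) := by
  have hm0 : (0 : ℝ) < m := by exact_mod_cast (by omega : 0 < m)
  refine ⟨mul_nonneg hm0.le hx.1, ?_⟩
  rw [mul_comm, ← le_div_iff₀ hm0]
  exact hx.2.trans (min_le_left _ _)

theorem continuousOn_growth (hm : 3 ≤ m) :
    ContinuousOn (growth ℓ m θ) (Set.Icc 0 (maxWeight m θ)) := by
  have h1 : ContinuousOn (fun x => evenDual m (m * x)) (Set.Icc 0 (maxWeight m θ)) :=
    (continuousOn_evenDual m).comp (by fun_prop) fun x hx => mul_mem_of_mem hm hx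
  have h2 : Continuous fun x : ℝ => Real.binEntropy (x / θ) :=
    Real.binEntropy_continuous.comp (by fun_prop)
  unfold growth
  exact ((h1.const_mul _).sub (Real.binEntropy_continuous.continuousOn.const_mul _)).add
    (h2.continuousOn.const_mul _)

theorem growth_zero : growth ℓ m θ 0 = 0 := by
  simp [growth, evenDual_zero]

theorem evenDual_steep (hm : 3 ≤ m) (L : ℝ) :
    ∀ᶠ y in 𝓝[<] ((2 * (m / 2) : ℕ) : ℝ),
      evenDual m (2 * (m / 2) : ℕ) + L * ((2 * (m / 2) : ℕ) - y) ≤ evenDual m y := by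
  obtain ⟨V, hV, hVc⟩ := exists_mem_evens_card m
  have := dualFn_steep (κ := fun U : Finset (Fin m) => (U.card : ℝ)) (empty_mem_evens m) hV
    (by rw [hVc]; simp only [Finset.card_empty]; exact_mod_cast (by omega : 0 < 2 * (m / 2)))
    (fun k hk => by rw [hVc]; exact_mod_cast card_le_of_mem_evens hk) L
  rwa [hVc] at this

/-- For odd `m`, the growth rate is not maximal at the weight `1 - 1/m`. -/
theorem not_isMaxOn_growth (hℓ : 0 < ℓ) (hm : 3 ≤ m) (hodd : Odd m) (hθ0 : 0 < θ)
    (hb : 1 - 1 / (m : ℝ) ≤ θ) :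
    ¬ IsMaxOn (growth ℓ m θ) (Set.Icc 0 (maxWeight m θ)) (1 - 1 / (m : ℝ)) := by
  intro hmax
  have hm0 : (0 : ℝ) < m := by exact_mod_cast (by omega : 0 < m)
  have hℓ0 : (0 : ℝ) < ℓ := by exact_mod_cast hℓ
  set b : ℝ := 1 - 1 / (m : ℝ) with hbdef
  have hmb : (m : ℝ) * b = (2 * (m / 2) : ℕ) := by
    rw [cast_two_mul_half_of_odd hodd, hbdef]; field_simp
  have hmw : maxWeight m θ = b := by
    rw [maxWeight, ← hmb, mul_div_cancel_left₀ _ hm0.ne', min_eq_left hb]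
  have hb1 : b < 1 := by
    have : 0 < 1 / (m : ℝ) := by positivity
    linarith
  have hb0 : 0 < b := by rw [← hmw]; exact maxWeight_pos hm hθ0
  -- A minorant of `θ * binEntropy (x / θ)` that touches it at `b` and is differentiable there. If
  -- `b = θ` the entropy itself has infinite slope at `b`, and the zero function is used.
  obtain ⟨k, d, hk, hkle, hkb⟩ : ∃ (k : ℝ → ℝ) (d : ℝ), HasDerivAt k d b ∧
      (∀ x ∈ Set.Icc 0 b, k x ≤ θ * Real.binEntropy (x / θ)) ∧
      k b = θ * Real.binEntropy (b / θ) := by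
    rcases hb.eq_or_lt with h | h
    · refine ⟨fun _ => 0, 0, hasDerivAt_const _ _, fun x hx => ?_, ?_⟩
      · refine mul_nonneg hθ0.le (Real.binEntropy_nonneg (div_nonneg hx.1 hθ0.le) ?_)
        rw [div_le_one hθ0, ← h]
        exact hx.2
      · rw [← h, div_self hb0.ne']; simp
    · have h1 : 0 < b / θ := div_pos hb0 hθ0
      have h2 : b / θ < 1 := (div_lt_one hθ0).2 h
      have h3 := ((Real.hasDerivAt_binEntropy h1.ne' h2.ne).comp b
        ((hasDerivAt_id b).div_const θ)).const_mul θ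
      exact ⟨fun x => θ * Real.binEntropy (x / θ), _, h3, fun x _ => le_rfl, rfl⟩
  obtain ⟨d', hK⟩ : ∃ d', HasDerivAt (fun x => k x - ℓ * Real.binEntropy x) d' b :=
    ⟨_, hk.fun_sub ((Real.hasDerivAt_binEntropy hb0.ne' hb1.ne).const_mul (ℓ : ℝ))⟩
  have htend : Tendsto (fun x : ℝ => (m : ℝ) * x) (𝓝[<] b) (𝓝[<] ((2 * (m / 2) : ℕ) : ℝ)) := by
    rw [← hmb]
    refine tendsto_nhdsWithin_iff.2 ⟨?_, ?_⟩
    · exact (Continuous.tendsto (by fun_prop) b).mono_left nhdsWithin_le_nhds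
    · filter_upwards [self_mem_nhdsWithin] with x hx
      exact mul_lt_mul_of_pos_left hx hm0
  -- The slope `(d' + 1) / ℓ` becomes `d' + 1` after rescaling, which beats the derivative `d'` of
  -- the remaining terms; a small step to the left of `b` therefore increases the growth rate.
  have hsteep := htend.eventually (evenDual_steep hm ((d' + 1) / ℓ))
  have hslope := (hasDerivAt_iff_tendsto_slope.1 hK).mono_left
    (nhdsWithin_mono b fun x (hx : x ∈ Set.Iio b) => (ne_of_lt hx : x ≠ b))
  have hlt := hslope.eventually_lt_const (lt_add_one d')
  obtain ⟨x, ⟨hx1, hx2⟩, hx3⟩ := ((hsteep.and hlt).and (Ioo_mem_nhdsLT hb0)).exists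
  have hle : growth ℓ m θ x ≤ growth ℓ m θ b :=
    hmax ⟨hx3.1.le, by rw [hmw]; exact hx3.2.le⟩
  rw [growth, growth, hmb, ← hkb] at hle
  have hkx := hkle x ⟨hx3.1.le, hx3.2.le⟩
  rw [slope_def_field, div_lt_iff_of_neg (by linarith [hx3.2])] at hx2
  rw [← hmb] at hx1 hle
  have h5 := mul_le_mul_of_nonneg_left hx1 (by positivity : 0 ≤ (ℓ : ℝ) / m)
  have h6 : (ℓ : ℝ) / m * (evenDual m (m * b) + (d' + 1) / ℓ * (m * b - m * x)) =
      ℓ / m * evenDual m (m * b) + (d' + 1) * (b - x) := by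
    field_simp
  rw [h6] at h5
  nlinarith

/-- The maximal growth rate, and its relation to the objective. -/
theorem exists_max_growth (hℓ : 0 < ℓ) (hm : 3 ≤ m) (hθ0 : 0 < θ) (hθ1 : θ ≤ 1) :
    ∃ F : ℝ, (∀ x ∈ Set.Icc 0 (maxWeight m θ), growth ℓ m θ x ≤ F) ∧
      (∀ c < F, ∃ x ∈ Set.Ioo 0 (maxWeight m θ), c < growth ℓ m θ x) ∧
      IsLUB (objective ℓ m θ '' Set.Ioc 0 1) ((F / Real.log 2 : ℝ) : EReal) ∧
      (0 < F → IsGreatest (objective ℓ m θ '' Set.Ioc 0 1) ((F / Real.log 2 : ℝ) : EReal)) := by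
  have hm0 : (0 : ℝ) < m := by exact_mod_cast (by omega : 0 < m)
  have hc := maxWeight_pos hm hθ0
  have hlog : 0 < Real.log 2 := Real.log_pos one_lt_two
  have hmwθ : maxWeight m θ ≤ θ := min_le_right _ _
  obtain ⟨x₀, hx₀, hmax⟩ := isCompact_Icc.exists_isMaxOn (Set.nonempty_Icc.2 hc.le)
    (continuousOn_growth (ℓ := ℓ) hm)
  -- By continuity, points of the open interval come arbitrarily close to the maximum, even when
  -- `x₀` is an end point that the objective misses.
  have hdense : ∀ c < growth ℓ m θ x₀, ∃ x ∈ Set.Ioo 0 (maxWeight m θ), c < growth ℓ m θ x := by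
    intro c hcF
    have h1 : ∀ᶠ x in 𝓝[Set.Ioo 0 (maxWeight m θ)] x₀, c < growth ℓ m θ x :=
      ((continuousOn_growth hm x₀ hx₀).eventually_const_lt hcF).filter_mono
        (nhdsWithin_mono _ Set.Ioo_subset_Icc_self)
    have : (𝓝[Set.Ioo 0 (maxWeight m θ)] x₀).NeBot := by
      rw [← mem_closure_iff_nhdsWithin_neBot, closure_Ioo hc.ne]
      exact hx₀
    obtain ⟨x, hx1, hx2⟩ := (h1.and self_mem_nhdsWithin).exists
    exact ⟨x, hx2, hx1⟩
  have hgood : ∀ x ∈ Set.Icc 0 (maxWeight m θ), x ≠ 0 → ¬ (Odd m ∧ 1 - 1 / (m : ℝ) ≤ x) →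
      ((growth ℓ m θ x / Real.log 2 : ℝ) : EReal) ∈ objective ℓ m θ '' Set.Ioc 0 1 := by
    intro x hx hx0 hbad
    have hβ : x / θ ∈ Set.Ioc (0 : ℝ) 1 :=
      ⟨div_pos (lt_of_le_of_ne hx.1 hx0.symm) hθ0, (div_le_one hθ0).2 (hx.2.trans hmwθ)⟩
    refine ⟨x / θ, hβ, ?_⟩
    have hx' : x / θ * θ = x := div_mul_cancel₀ _ hθ0.ne'
    rw [objective_eq hm hθ0 hθ1 hβ (by rwa [hx']), hx']
  have hedge : ∀ x, x ≤ maxWeight m θ → Odd m → 1 - 1 / (m : ℝ) ≤ x → x = 1 - 1 / (m : ℝ) := by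
    intro x hx ho hle
    refine le_antisymm (hx.trans ((min_le_left _ _).trans_eq ?_)) hle
    rw [cast_two_mul_half_of_odd ho]
    field_simp
  have hub : ((growth ℓ m θ x₀ / Real.log 2 : ℝ) : EReal) ∈
      upperBounds (objective ℓ m θ '' Set.Ioc 0 1) := by
    rintro _ ⟨β, hβ, rfl⟩
    by_cases hbad : Odd m ∧ 1 - 1 / (m : ℝ) ≤ β * θ
    · rw [objective_eq_bot hbad]
      exact bot_le
    · rw [objective_eq hm hθ0 hθ1 hβ hbad, EReal.coe_le_coe_iff]
      refine div_le_div_of_nonneg_right (hmax ⟨(mul_pos hβ.1 hθ0).le, le_min ?_ ?_⟩) hlog.le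
      · rcases Nat.even_or_odd m with he | ho
        · rw [two_mul_half_of_even he, div_self hm0.ne']
          nlinarith [hβ.1, hβ.2]
        · rw [cast_two_mul_half_of_odd ho, sub_div, div_self hm0.ne']
          by_contra! hlt
          exact hbad ⟨ho, hlt.le⟩
      · nlinarith [hβ.1, hβ.2]
  refine ⟨growth ℓ m θ x₀, fun x hx => hmax hx, hdense, ⟨hub, fun a ha => ?_⟩, fun hF => ⟨?_, hub⟩⟩
  · refine le_of_forall_lt fun c hcF => ?_
    obtain ⟨z, hcz, hzF⟩ := EReal.lt_iff_exists_real_btwn.1 hcF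
    rw [EReal.coe_lt_coe_iff, lt_div_iff₀ hlog] at hzF
    obtain ⟨x, hx, hlt⟩ := hdense _ hzF
    have hx' : x ∈ Set.Icc 0 (maxWeight m θ) := Set.Ioo_subset_Icc_self hx
    refine hcz.trans (lt_of_lt_of_le ?_ (ha (hgood x hx' hx.1.ne' ?_)))
    · rw [EReal.coe_lt_coe_iff, lt_div_iff₀ hlog]
      exact hlt
    · rintro ⟨ho, hle⟩
      have := hedge _ le_rfl ho (hle.trans hx.2.le)
      linarith [hx.2]
  · refine hgood x₀ hx₀ ?_ ?_
    · rintro rfl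
      rw [growth_zero] at hF
      exact hF.false
    · rintro ⟨ho, hle⟩
      have hx₀' := hedge x₀ hx₀.2 ho hle
      rw [hx₀'] at hmax
      refine not_isMaxOn_growth hℓ hm ho hθ0 ?_ hmax
      rw [← hx₀']
      exact hx₀.2.trans hmwθ

end Objective

/-! ### Exponential upper and lower bounds for the mean -/

section Asymptotics

variable {ℓ m r n : ℕ} {θ : ℝ}

theorem eventually_mul_pow_le_exp (C : ℝ) (D : ℕ) {δ : ℝ} (hδ : 0 < δ) :
    ∀ᶠ n : ℕ in atTop, C * (n : ℝ) ^ D ≤ Real.exp (n * δ) := by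
  have h1 : Tendsto (fun n : ℕ => C * ((n : ℝ) ^ D / Real.exp (δ * n))) atTop (𝓝 (C * 0)) :=
    (((isLittleO_pow_exp_pos_mul_atTop D hδ).tendsto_div_nhds_zero).comp
      tendsto_natCast_atTop_atTop).const_mul C
  rw [mul_zero] at h1
  filter_upwards [h1.eventually_lt_const one_pos] with n hn
  rw [mul_div_assoc', div_lt_one (Real.exp_pos _), mul_comm δ] at hn
  exact hn.le

theorem polyLoss_cast (ℓ m n : ℕ) :
    (polyLoss ℓ m n : ℝ) =
      2 * (ℓ : ℝ) ^ (2 * (8 * (ℓ * m))) * (n : ℝ) ^ (2 * (8 * (ℓ * m))) := by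
  rw [polyLoss]
  push_cast
  rw [← pow_mul, mul_pow]
  ring

/-- Chernoff's bound holds for every `u`; the infimum over `u` is the dual function. -/
theorem evenCount_le_exp_evenDual (hr : 0 < r) {v : ℕ} {y : ℝ} (hv : (v : ℝ) = r * y) :
    (evenCount r m v : ℝ) ≤ Real.exp (r * evenDual m y) := by
  rcases Nat.eq_zero_or_pos (evenCount r m v) with h | h
  · rw [h, Nat.cast_zero]
    exact (Real.exp_pos _).le
  have hA : (0 : ℝ) < evenCount r m v := by exact_mod_cast h
  have hr' : (0 : ℝ) < r := by exact_mod_cast hr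
  rw [← Real.log_le_iff_le_exp hA, mul_comm, ← div_le_iff₀ hr']
  refine le_ciInf fun u => ?_
  have h1 := evenCount_mul_exp_le r m v u
  have h2 := Real.log_le_log (by positivity) h1
  rw [Real.log_mul hA.ne' (Real.exp_ne_zero _), Real.log_exp, Real.log_pow, hv] at h2
  change _ ≤ Real.log (evenZ m u) - y * u
  rw [div_le_iff₀ hr']
  nlinarith

/-- The upper entropy bound for the first binomial coefficient, Chernoff's bound for `evenCount` and
the lower entropy bound for the denominator combine into `growth` at `w / n`; the last one costs the
factor `n * ℓ + 1`. Weights beyond `maxWeight` contribute nothing. -/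
theorem term_le (hℓ : 0 < ℓ) (hm : 3 ≤ m) (hθ0 : 0 < θ) (hr : n * ℓ = r * m) (hn : 0 < n)
    {F : ℝ} (hF : ∀ x ∈ Set.Icc 0 (maxWeight m θ), growth ℓ m θ x ≤ F) {w : ℕ}
    (hw0 : 0 < w) (hw : w ≤ ⌊θ * (n : ℝ)⌋₊) :
    (⌊θ * (n : ℝ)⌋₊.choose w : ℝ) * (evenCount r m (w * ℓ) / (r * m).choose (w * ℓ)) ≤
      (n * ℓ + 1) * Real.exp (n * F) := by
  have hn0 : (0 : ℝ) < n := by exact_mod_cast hn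
  have hℓ0 : (0 : ℝ) < ℓ := by exact_mod_cast hℓ
  have hm0 : (0 : ℝ) < m := by exact_mod_cast (by omega : 0 < m)
  have hr0 : 0 < r := Nat.pos_of_mul_pos_right (hr ▸ Nat.mul_pos hn hℓ)
  by_cases hbig : r * (2 * (m / 2)) < w * ℓ
  · rw [evenCount_eq_zero hbig]
    simp only [Nat.cast_zero, zero_div, mul_zero]
    positivity
  have hrR : (n : ℝ) * ℓ = r * m := by exact_mod_cast hr
  set M : ℕ := 2 * (m / 2) with hM
  set x : ℝ := w / n with hx
  have hwθ : (w : ℝ) ≤ θ * n := (Nat.le_floor_iff (by positivity)).1 hw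
  have hwM : (w : ℝ) * m ≤ n * M := by
    have : w * ℓ * m ≤ r * M * m := Nat.mul_le_mul_right _ (not_lt.1 hbig)
    have h2 : ℓ * (w * m) ≤ ℓ * (n * M) := by
      calc _ = w * ℓ * m := by ring
        _ ≤ r * M * m := this
        _ = r * m * M := by ring
        _ = _ := by rw [← hr]; ring
    exact_mod_cast Nat.le_of_mul_le_mul_left h2 hℓ
  have hxI : x ∈ Set.Icc 0 (maxWeight m θ) := by
    refine ⟨by positivity, le_min ?_ ?_⟩
    · rw [hx, div_le_div_iff₀ hn0 hm0, mul_comm (M : ℝ)]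
      exact hwM
    · rw [hx, div_le_iff₀ hn0]
      exact hwθ
  have hwn : w * ℓ ≤ r * m := by
    refine (not_lt.1 hbig).trans (Nat.mul_le_mul_left _ ?_)
    omega
  have h1 := choose_le_exp_binEntropy (J := ⌊θ * (n : ℝ)⌋₊) (a := θ * n)
    (Nat.floor_le (by positivity)) hw0 hw
  have h2 := exp_binEntropy_le_choose hwn
  have h3 := evenCount_le_exp_evenDual (m := m) hr0 (v := w * ℓ) (y := m * x) (by
    push_cast
    rw [← mul_assoc, ← hrR, hx]
    field_simp)
  have e1 : (w : ℝ) / (θ * n) = x / θ := by rw [hx, div_div, mul_comm θ]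
  have e2 : ((w * ℓ : ℕ) : ℝ) / (r * m : ℕ) = x := by
    push_cast
    rw [← hrR, hx, mul_div_mul_right _ _ hℓ0.ne']
  rw [e1] at h1
  rw [e2] at h2
  have h4 : (0 : ℝ) < (r * m).choose (w * ℓ) := by exact_mod_cast Nat.choose_pos hwn
  have hrm : (((r * m : ℕ)) : ℝ) = n * ℓ := by push_cast; exact hrR.symm
  rw [hrm] at h2
  have hrn : (r : ℝ) = n * (ℓ / m) := by
    field_simp
    linarith
  rw [mul_div_assoc', div_le_iff₀ h4]
  calc _ ≤ Real.exp (θ * n * Real.binEntropy (x / θ)) * Real.exp (r * evenDual m (m * x)) := by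
        gcongr
    _ = Real.exp (n * growth ℓ m θ x) * Real.exp (n * ℓ * Real.binEntropy x) := by
        rw [← Real.exp_add, ← Real.exp_add, growth, hrn]
        congr 1
        ring
    _ ≤ Real.exp (n * F) * ((n * ℓ + 1) * (r * m).choose (w * ℓ)) := by
        have := hF x hxI
        gcongr
    _ = _ := by ring

theorem div_mul_eq_of_dvd (hd : m ∣ ℓ * n) : n * ℓ = ℓ * n / m * m := by
  rw [Nat.div_mul_cancel hd, mul_comm]

theorem avgNonzero_le (hℓ : 0 < ℓ) (hm : 3 ≤ m) (hθ0 : 0 < θ) (hd : m ∣ ℓ * n)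
    (hn : 2 * m < n) {F : ℝ} (hF : ∀ x ∈ Set.Icc 0 (maxWeight m θ), growth ℓ m θ x ≤ F)
    {J : Finset (Fin n)} (hJ : J.card = ⌊θ * (n : ℝ)⌋₊) :
    avgNonzero ℓ m n J ≤ n * (polyLoss ℓ m n * ((n * ℓ + 1) * Real.exp (n * F))) := by
  have hr := div_mul_eq_of_dvd hd
  rw [avgNonzero_eq_sum]
  set r := ℓ * n / m
  -- The value `0` at `w = 0` lets the sum run over the whole powerset, where it can be grouped by
  -- cardinality.
  set g : ℕ → ℝ := fun w => if w = 0 then 0 else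
    polyLoss ℓ m n * (evenCount r m (w * ℓ) / (r * m).choose (w * ℓ)) with hg
  calc _ ≤ ∑ T ∈ J.powerset.erase ∅, g T.card := by
        refine Finset.sum_le_sum fun T hT => ?_
        have hT0 : T.card ≠ 0 := by
          rw [Finset.card_ne_zero]
          exact Finset.nonempty_iff_ne_empty.2 (Finset.ne_of_mem_erase hT)
        rw [hg]
        simp only [if_neg hT0]
        exact numEvenOn_div_le hr hℓ hn T
    _ = ∑ T ∈ J.powerset, g T.card := Finset.sum_erase _ (by simp [hg])
    _ = ∑ w ∈ Finset.range (J.card + 1), J.card.choose w • g w :=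
        Finset.sum_powerset_apply_card g
    _ = ∑ w ∈ Finset.range J.card, J.card.choose (w + 1) • g (w + 1) := by
        rw [Finset.sum_range_succ']
        simp [hg]
    _ ≤ ∑ w ∈ Finset.range J.card, polyLoss ℓ m n * ((n * ℓ + 1) * Real.exp (n * F)) := by
        refine Finset.sum_le_sum fun w hw => ?_
        rw [Finset.mem_range] at hw
        have := term_le hℓ hm hθ0 hr (by omega) hF (Nat.succ_pos w) (hJ ▸ hw)
        rw [hg, nsmul_eq_mul]
        simp only [Nat.succ_ne_zero, if_false]
        rw [mul_left_comm, hJ]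
        gcongr
    _ ≤ _ := by
        rw [Finset.sum_const, Finset.card_range, nsmul_eq_mul]
        have : J.card ≤ n := by simpa using Finset.card_le_univ J
        gcongr

theorem eventually_avgNonzero_le (hℓ : 0 < ℓ) (hm : 3 ≤ m) (hθ0 : 0 < θ)
    {J : ∀ n : ℕ, Finset (Fin n)} (hJ : ∀ n : ℕ, (J n).card = ⌊θ * (n : ℝ)⌋₊)
    {F : ℝ} (hF : ∀ x ∈ Set.Icc 0 (maxWeight m θ), growth ℓ m θ x ≤ F) {c : ℝ} (hc : F < c) :
    ∀ᶠ n : ℕ in atTop, m ∣ ℓ * n → avgNonzero ℓ m n (J n) ≤ Real.exp (n * c) := by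
  filter_upwards [eventually_mul_pow_le_exp (4 * (ℓ : ℝ) ^ (2 * (8 * (ℓ * m)) + 1))
    (2 * (8 * (ℓ * m)) + 2) (sub_pos.2 hc), eventually_gt_atTop (2 * m)] with n hpoly hn hd
  have hn1 : (1 : ℝ) ≤ n := by exact_mod_cast (by omega : 1 ≤ n)
  have hℓ1 : (1 : ℝ) ≤ ℓ := by exact_mod_cast hℓ
  calc _ ≤ _ := avgNonzero_le hℓ hm hθ0 hd hn hF (hJ n)
    _ ≤ n * (polyLoss ℓ m n * ((2 * (n * ℓ)) * Real.exp (n * F))) := by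
        gcongr
        nlinarith
    _ = (4 * (ℓ : ℝ) ^ (2 * (8 * (ℓ * m)) + 1) * (n : ℝ) ^ (2 * (8 * (ℓ * m)) + 2)) *
          Real.exp (n * F) := by
        rw [polyLoss_cast]; ring
    _ ≤ Real.exp (n * (c - F)) * Real.exp (n * F) := by gcongr
    _ = _ := by rw [← Real.exp_add]; congr 1; ring

/-- One weight class gives a lower bound for the mean number of codewords. -/
theorem term_le_avgNonzero (hℓ : 0 < ℓ) (hd : m ∣ ℓ * n) (hn : 2 * m < n) {J : Finset (Fin n)}
    {w : ℕ} (hw : 2 * m < w) (hw' : 2 * m < n - w) :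
    (J.card.choose w : ℝ) * (evenCount (ℓ * n / m) m (w * ℓ) /
      (ℓ * n / m * m).choose (w * ℓ)) ≤ polyLoss ℓ m n * avgNonzero ℓ m n J := by
  have hr := div_mul_eq_of_dvd hd
  rw [avgNonzero_eq_sum]
  set r := ℓ * n / m
  calc _ = ∑ T ∈ J.powersetCard w, (evenCount r m (T.card * ℓ) /
          (r * m).choose (T.card * ℓ) : ℝ) := by
        rw [Finset.sum_congr rfl (g := fun _ => (evenCount r m (w * ℓ) /
          (r * m).choose (w * ℓ) : ℝ)), Finset.sum_const, Finset.card_powersetCard, nsmul_eq_mul]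
        intro T hT
        rw [(Finset.mem_powersetCard.1 hT).2]
    _ ≤ ∑ T ∈ J.powersetCard w, polyLoss ℓ m n *
          ((numEvenOn ℓ m r T : ℝ) / (ensemble ℓ m r n).card) := by
        refine Finset.sum_le_sum fun T hT => ?_
        have hTw := (Finset.mem_powersetCard.1 hT).2
        exact evenCount_div_le hr hℓ hn T (hTw ▸ hw) (hTw ▸ hw')
    _ ≤ _ := by
        rw [← Finset.mul_sum]
        gcongr
        intro T hT
        rw [Finset.mem_powersetCard] at hT
        refine Finset.mem_erase.2 ⟨?_, Finset.mem_powerset.2 hT.1⟩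
        rintro rfl
        rw [Finset.card_empty] at hT
        omega

/-- The exponent of the weight `y n` in a code shortened to `a n` positions, with the generating
function evaluated at `u`. -/
noncomputable def growthAt (ℓ m : ℕ) (u : ℝ) (p : ℝ × ℝ) : ℝ :=
  (ℓ : ℝ) / m * Real.log (evenZ m u) - ℓ * p.1 * u - ℓ * Real.binEntropy p.1 +
    p.2 * Real.binEntropy (p.1 / p.2)

theorem continuousAt_growthAt (ℓ m : ℕ) (u : ℝ) {p : ℝ × ℝ} (hp : p.2 ≠ 0) :
    ContinuousAt (growthAt ℓ m u) p := by
  have h1 : ContinuousAt (fun p : ℝ × ℝ => Real.binEntropy p.1) p :=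
    Real.binEntropy_continuous.continuousAt.comp continuousAt_fst
  have h2 : ContinuousAt (fun p : ℝ × ℝ => Real.binEntropy (p.1 / p.2)) p :=
    ContinuousAt.comp' (g := Real.binEntropy) Real.binEntropy_continuous.continuousAt
      (continuousAt_fst.div continuousAt_snd hp)
  unfold growthAt
  exact ((continuousAt_const.sub (by fun_prop)).sub (h1.const_mul _)).add
    (continuousAt_snd.mul h2)

/-- With `u` fixed, the exponent is an explicit continuous function of `w / n` and `J / n`, so the
lower bound tolerates weights near the target and the rounding in `J`. -/
theorem exp_growthAt_le (hℓ : 0 < ℓ) (hℓm : ℓ ≤ m) (hr : n * ℓ = r * m) (hn : 0 < n) (u : ℝ)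
    {J w : ℕ} (hJn : J ≤ n) (hw0 : 0 < w) (hwJ : w ≤ J)
    (hlarge : evenZ m u ^ r ≤ (r * m + 1) * (r * 2 ^ m) ^ ℓ * Real.exp (2 * ℓ * |u|) *
        (evenCount r m (w * ℓ) * Real.exp (u * (w * ℓ : ℕ)))) :
    Real.exp (n * growthAt ℓ m u (w / n, J / n)) ≤
      (4 * ℓ * 2 ^ (m * ℓ) * Real.exp (2 * ℓ * |u|)) * (n : ℝ) ^ (ℓ + 2) *
        ((J.choose w : ℝ) * (evenCount r m (w * ℓ) / (r * m).choose (w * ℓ))) := by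
  have hn1 : (1 : ℝ) ≤ n := by exact_mod_cast hn
  have hn0 : (0 : ℝ) < n := by linarith
  have hℓ1 : (1 : ℝ) ≤ ℓ := by exact_mod_cast hℓ
  have hℓ0 : (0 : ℝ) < ℓ := by linarith
  have hm0 : (0 : ℝ) < m := by exact_mod_cast (by omega : 0 < m)
  have hJ0 : (0 : ℝ) < J := by exact_mod_cast (by omega : 0 < J)
  have hJn' : (J : ℝ) ≤ n := by exact_mod_cast hJn
  have hrR : (n : ℝ) * ℓ = r * m := by exact_mod_cast hr
  have hwn : w * ℓ ≤ r * m := by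
    rw [← hr]; exact Nat.mul_le_mul_right _ (hwJ.trans hJn)
  have hC0 : (0 : ℝ) < (r * m).choose (w * ℓ) := by exact_mod_cast Nat.choose_pos hwn
  have hrn : (r : ℝ) = n * (ℓ / m) := by
    field_simp
    linarith
  have hrn' : (r : ℝ) ≤ n := by
    rw [hrn]
    have : (ℓ : ℝ) ≤ m := by exact_mod_cast hℓm
    exact mul_le_of_le_one_right hn0.le ((div_le_one hm0).2 this)
  have h1 := exp_binEntropy_le_choose hwJ
  have h2 := choose_le_exp_binEntropy (J := r * m) (a := n * ℓ) (by push_cast; exact hrR.ge)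
    (Nat.mul_pos hw0 hℓ) hwn
  have e2 : ((w * ℓ : ℕ) : ℝ) / (n * ℓ) = w / n := by
    push_cast
    rw [mul_div_mul_right _ _ hℓ0.ne']
  rw [e2] at h2
  have e1 : (w : ℝ) / n / (J / n) = w / J := by
    rw [div_div_div_cancel_right₀ hn0.ne']
  have hZ : evenZ m u ^ r = Real.exp (r * Real.log (evenZ m u)) := by
    rw [mul_comm, Real.exp_mul, Real.exp_log (evenZ_pos m u), Real.rpow_natCast]
  rw [hZ] at hlarge
  have hexp : Real.exp (n * growthAt ℓ m u (w / n, J / n)) *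
      Real.exp (n * ℓ * Real.binEntropy (w / n)) * Real.exp (u * (w * ℓ : ℕ)) =
      Real.exp (r * Real.log (evenZ m u)) * Real.exp (J * Real.binEntropy (w / J)) := by
    rw [← Real.exp_add, ← Real.exp_add, ← Real.exp_add, growthAt, e1, hrn]
    congr 1
    push_cast
    field_simp
    ring
  rw [mul_div_assoc', mul_div_assoc', le_div_iff₀ hC0]
  refine le_of_mul_le_mul_right ?_ (Real.exp_pos (u * (w * ℓ : ℕ)))
  have a1 : (r : ℝ) * m + 1 ≤ 2 * ℓ * n := by rw [← hrR]; nlinarith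
  have a2 : (J : ℝ) + 1 ≤ 2 * n := by linarith
  have a3 : ((r : ℝ) * 2 ^ m) ^ ℓ ≤ n ^ ℓ * 2 ^ (m * ℓ) := by
    rw [mul_pow, ← pow_mul]
    gcongr
  calc _ ≤ Real.exp (n * growthAt ℓ m u (w / n, J / n)) *
          Real.exp (n * ℓ * Real.binEntropy (w / n)) * Real.exp (u * (w * ℓ : ℕ)) := by
        gcongr
    _ = _ := hexp
    _ ≤ ((r * m + 1) * (r * 2 ^ m) ^ ℓ * Real.exp (2 * ℓ * |u|) *
        (evenCount r m (w * ℓ) * Real.exp (u * (w * ℓ : ℕ)))) * ((J + 1) * J.choose w) := by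
        gcongr
    _ ≤ ((2 * ℓ * n) * (n ^ ℓ * 2 ^ (m * ℓ)) * Real.exp (2 * ℓ * |u|) *
        (evenCount r m (w * ℓ) * Real.exp (u * (w * ℓ : ℕ)))) * ((2 * n) * J.choose w) := by
        gcongr
    _ = _ := by ring

/-- Tilting by the `u` of mean `m * x` makes `growthAt` agree with `growth` at `(x, θ)`. One large
coefficient at a weight near `x * n` gives the bound, since its polynomial losses fit in the gap
between `c` and `c'`. -/
theorem eventually_le_avgNonzero (hℓ : 0 < ℓ) (hm : 3 ≤ m) (hℓm : ℓ ≤ m) (hθ0 : 0 < θ)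
    (hθ1 : θ ≤ 1) {J : ∀ n : ℕ, Finset (Fin n)} (hJ : ∀ n : ℕ, (J n).card = ⌊θ * (n : ℝ)⌋₊)
    {x : ℝ} (hx : x ∈ Set.Ioo 0 (maxWeight m θ)) {c : ℝ} (hc : c < growth ℓ m θ x) :
    ∀ᶠ n : ℕ in atTop, m ∣ ℓ * n → Real.exp (n * c) ≤ avgNonzero ℓ m n (J n) := by
  have hm0 : (0 : ℝ) < m := by exact_mod_cast (by omega : 0 < m)
  have hm1 : (1 : ℝ) ≤ m := by exact_mod_cast (by omega : 1 ≤ m)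
  have hℓ0 : (0 : ℝ) < ℓ := by exact_mod_cast hℓ
  obtain ⟨hx0, hx1⟩ := hx
  have hxθ : x < θ := hx1.trans_le (min_le_right _ _)
  have hxM : (m : ℝ) * x < (2 * (m / 2) : ℕ) := by
    rw [mul_comm, ← lt_div_iff₀ hm0]
    exact hx1.trans_le (min_le_left _ _)
  obtain ⟨u, hu⟩ := exists_evenMean_eq (mul_pos hm0 hx0) hxM
  obtain ⟨c', hcc', hc'⟩ := exists_between hc
  have hgrow : growth ℓ m θ x = growthAt ℓ m u (x, θ) := by
    have := evenDual_evenMean m u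
    rw [hu] at this
    rw [growth, growthAt, this]
    field_simp
  rw [hgrow] at hc'
  have hev := (continuousAt_growthAt ℓ m u (p := (x, θ)) hθ0.ne').eventually_const_lt hc'
  obtain ⟨ε₀, hε₀, hball⟩ := Metric.eventually_nhds_iff.1 hev
  -- The three bounds keep the pair of ratios in the `ε₀`-ball, force `w / n ≥ ε`, and ensure both
  -- `w ≤ (J n).card` and `w / n + ε ≤ 1`. As `ε * n` exceeds `2 * m`, both switching classes are
  -- large enough.
  set ε := min (ε₀ / 2) (min (x / 2) ((θ - x) / 4)) with hεdef
  have hε : 0 < ε := lt_min (by linarith) (lt_min (by linarith) (by linarith))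
  have hε1 : ε ≤ ε₀ / 2 := min_le_left _ _
  have hε2 : ε ≤ x / 2 := (min_le_right _ _).trans (min_le_left _ _)
  have hε3 : ε ≤ (θ - x) / 4 := (min_le_right _ _).trans (min_le_right _ _)
  obtain ⟨R, hR⟩ := eventually_atTop.1 (exists_evenCount_mul_large hℓ (by omega : 2 ≤ m) u hε)
  have hfloor : Tendsto (fun n : ℕ => (⌊θ * (n : ℝ)⌋₊ : ℝ) / n) atTop (𝓝 θ) :=
    (tendsto_nat_floor_mul_div_atTop hθ0.le).comp tendsto_natCast_atTop_atTop
  have hfl := hfloor.eventually (Metric.ball_mem_nhds θ hε)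
  have hlin : ∀ᶠ n : ℕ in atTop, 2 * (m : ℝ) < ε * n :=
    (tendsto_natCast_atTop_atTop.const_mul_atTop hε).eventually_gt_atTop _
  filter_upwards [hfl, hlin, eventually_gt_atTop (2 * m), eventually_ge_atTop (R * m),
    eventually_mul_pow_le_exp (2 * (ℓ : ℝ) ^ (2 * (8 * (ℓ * m))) *
      (4 * ℓ * 2 ^ (m * ℓ) * Real.exp (2 * ℓ * |u|))) (2 * (8 * (ℓ * m)) + (ℓ + 2))
      (sub_pos.2 hcc')] with n hn1 hn2 hn3 hn4 hn5 hd
  have hn0 : (0 : ℝ) < n := by exact_mod_cast (by omega : 0 < n)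
  have hr := div_mul_eq_of_dvd hd
  have hterm := fun w => term_le_avgNonzero (J := J n) (w := w) hℓ hd hn3
  set r := ℓ * n / m with hrdef
  have hrR : R ≤ r := by
    rw [hrdef, Nat.le_div_iff_mul_le (by omega)]
    exact hn4.trans (Nat.le_mul_of_pos_left n hℓ)
  obtain ⟨w, hw, hlarge⟩ := hR r hrR
  have hrn : (n : ℝ) * ℓ = r * m := by exact_mod_cast hr
  rw [← hJ n, Real.dist_eq, abs_lt] at hn1
  have hJn : (J n).card ≤ n := by simpa using Finset.card_le_univ (J n)
  have hwx : |(w : ℝ) / n - x| ≤ ε := by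
    have h1 : ((w * ℓ : ℕ) : ℝ) - evenMean m u * r = (r * m) * ((w : ℝ) / n - x) := by
      rw [hu, ← hrn]
      push_cast
      have : (m : ℝ) * x * r = n * ℓ * x := by rw [hrn]; ring
      rw [this]
      field_simp
    have hr0 : (0 : ℝ) < r := by
      have : 0 < (r : ℝ) * m := by rw [← hrn]; positivity
      exact pos_of_mul_pos_left this hm0.le
    rw [h1, abs_mul, abs_of_pos (by positivity), mul_assoc, mul_comm ε] at hw
    have h2 := le_of_mul_le_mul_left hw hr0
    have h3 := abs_nonneg ((w : ℝ) / n - x)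
    nlinarith
  have hdist : dist ((w : ℝ) / n, ((J n).card : ℝ) / n) (x, θ) < ε₀ := by
    rw [Prod.dist_eq, max_lt_iff, Real.dist_eq, Real.dist_eq]
    refine ⟨by linarith, ?_⟩
    rw [abs_lt]
    constructor <;> linarith [hn1.1, hn1.2]
  have hgt := hball hdist
  rw [abs_le] at hwx
  have b1 : ε * n ≤ w := by
    rw [← le_div_iff₀ hn0]
    linarith
  have b2 : (w : ℝ) + ε * n ≤ n := by
    have : (w : ℝ) / n + ε ≤ 1 := by linarith
    calc _ = ((w : ℝ) / n + ε) * n := by field_simp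
      _ ≤ 1 * n := by gcongr
      _ = n := one_mul _
  have b3 : w ≤ (J n).card := by
    have : (w : ℝ) / n ≤ (J n).card / n := by linarith [hn1.1]
    rw [div_le_div_iff_of_pos_right hn0] at this
    exact_mod_cast this
  have b4 : 2 * m < w := by
    have : ((2 * m : ℕ) : ℝ) < w := by push_cast; linarith
    exact_mod_cast this
  have b5 : 2 * m + w < n := by
    have : ((2 * m + w : ℕ) : ℝ) < n := by push_cast; linarith
    exact_mod_cast this
  have hlow := exp_growthAt_le hℓ hℓm hr (by omega) u hJn (by omega) b3 hlarge
  have hup := hterm w b4 (by omega)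
  have hfin : Real.exp (n * c') ≤ Real.exp (n * (c' - c)) * avgNonzero ℓ m n (J n) := by
    calc Real.exp (n * c') ≤ Real.exp (n * growthAt ℓ m u (w / n, (J n).card / n)) := by gcongr
      _ ≤ _ := hlow
      _ ≤ (4 * ℓ * 2 ^ (m * ℓ) * Real.exp (2 * ℓ * |u|)) * (n : ℝ) ^ (ℓ + 2) *
          (polyLoss ℓ m n * avgNonzero ℓ m n (J n)) := by gcongr
      _ = (2 * (ℓ : ℝ) ^ (2 * (8 * (ℓ * m))) * (4 * ℓ * 2 ^ (m * ℓ) * Real.exp (2 * ℓ * |u|)) *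
          (n : ℝ) ^ (2 * (8 * (ℓ * m)) + (ℓ + 2))) * avgNonzero ℓ m n (J n) := by
          rw [polyLoss_cast]; ring
      _ ≤ _ := by
          have : 0 ≤ avgNonzero ℓ m n (J n) := by unfold avgNonzero; positivity
          gcongr
  refine le_of_mul_le_mul_left ?_ (Real.exp_pos (n * (c' - c)))
  refine le_trans (le_of_eq ?_) hfin
  rw [← Real.exp_add]
  congr 1
  ring

end Asymptotics

end LDPC

/-! ### The limit -/

theorem lemma2 (ℓ m : ℕ) (hℓ : 3 ≤ ℓ) (hm : ℓ ≤ m) (θ : ℝ) (hθ0 : 0 < θ) (hθ1 : θ ≤ 1)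
    (J : ∀ n : ℕ, Finset (Fin n)) (hJ : ∀ n : ℕ, (J n).card = ⌊θ * (n : ℝ)⌋₊) :
    ∃ f : ℝ,
      IsLUB (LDPC.objective ℓ m θ '' Set.Ioc 0 1) (f : EReal) ∧
      (0 < f → IsGreatest (LDPC.objective ℓ m θ '' Set.Ioc 0 1) (f : EReal)) ∧
      (∀ᶠ n : ℕ in atTop ⊓ 𝓟 {n : ℕ | m ∣ ℓ * n},
        (LDPC.ensemble ℓ m (ℓ * n / m) n).Nonempty ∧ 0 < LDPC.avgNonzero ℓ m n (J n)) ∧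
      Tendsto (fun n : ℕ => 1 / (n : ℝ) * Real.logb 2 (LDPC.avgNonzero ℓ m n (J n)))
        (atTop ⊓ 𝓟 {n : ℕ | m ∣ ℓ * n}) (𝓝 f) := by
  have hm3 : 3 ≤ m := hℓ.trans hm
  have hℓ0 : 0 < ℓ := by omega
  have hlog : 0 < Real.log 2 := Real.log_pos one_lt_two
  obtain ⟨F, hF, hdense, hlub, hgreatest⟩ := LDPC.exists_max_growth hℓ0 hm3 hθ0 hθ1
  have hlower : ∀ c < F, ∀ᶠ n : ℕ in atTop ⊓ 𝓟 {n : ℕ | m ∣ ℓ * n},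
      Real.exp (n * c) ≤ LDPC.avgNonzero ℓ m n (J n) := by
    intro c hc
    obtain ⟨x, hx, hcx⟩ := hdense c hc
    exact eventually_inf_principal.2
      (LDPC.eventually_le_avgNonzero hℓ0 hm3 hm hθ0 hθ1 hJ hx hcx)
  have hupper : ∀ c > F, ∀ᶠ n : ℕ in atTop ⊓ 𝓟 {n : ℕ | m ∣ ℓ * n},
      LDPC.avgNonzero ℓ m n (J n) ≤ Real.exp (n * c) := fun c hc =>
    eventually_inf_principal.2 (LDPC.eventually_avgNonzero_le hℓ0 hm3 hθ0 hJ hF hc)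
  -- Any exponential lower bound gives positivity, so the logarithm below is never taken at `0` for
  -- large `n`.
  have hpos : ∀ᶠ n : ℕ in atTop ⊓ 𝓟 {n : ℕ | m ∣ ℓ * n}, 0 < LDPC.avgNonzero ℓ m n (J n) :=
    (hlower (F - 1) (by linarith)).mono fun n hn => (Real.exp_pos _).trans_le hn
  have hn0 : ∀ᶠ n : ℕ in atTop ⊓ 𝓟 {n : ℕ | m ∣ ℓ * n}, 2 * m < n :=
    (eventually_gt_atTop _).filter_mono inf_le_left
  refine ⟨F / Real.log 2, hlub, fun h => hgreatest ((div_pos_iff_of_pos_right hlog).1 h), ?_, ?_⟩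
  · have hdvd : ∀ᶠ n : ℕ in atTop ⊓ 𝓟 {n : ℕ | m ∣ ℓ * n}, m ∣ ℓ * n :=
      eventually_inf_principal.2 (Eventually.of_forall fun n hn => hn)
    filter_upwards [hpos, hn0, hdvd] with n h1 h2 h3
    exact ⟨LDPC.ensemble_nonempty (LDPC.div_mul_eq_of_dvd h3) hℓ0 h2, h1⟩
  · have hrw : ∀ n : ℕ, 1 / (n : ℝ) * Real.logb 2 (LDPC.avgNonzero ℓ m n (J n)) =
        Real.log (LDPC.avgNonzero ℓ m n (J n)) / n / Real.log 2 := fun n => by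
      rw [Real.logb]; ring
    simp only [hrw]
    refine Tendsto.div_const (tendsto_order.2 ⟨fun a ha => ?_, fun a ha => ?_⟩) _
    · obtain ⟨c, hac, hcF⟩ := exists_between ha
      filter_upwards [hlower c hcF, hn0] with n h1 h2
      have hn : (0 : ℝ) < n := by exact_mod_cast (by omega : 0 < n)
      refine hac.trans_le ?_
      rw [le_div_iff₀ hn, mul_comm, Real.le_log_iff_exp_le ((Real.exp_pos _).trans_le h1)]
      exact h1
    · obtain ⟨c, hFc, hca⟩ := exists_between ha
      filter_upwards [hupper c hFc, hpos, hn0] with n h1 h2 h3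
      have hn : (0 : ℝ) < n := by exact_mod_cast (by omega : 0 < n)
      refine lt_of_le_of_lt ?_ hca
      rw [div_le_iff₀ hn, mul_comm, Real.log_le_iff_le_exp h2]
      exact h1
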